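/- Notation. An $n$-space group is a discrete subgroup $\Gamma$ of $\mathrm{Isom}(E^n)$ with $E^n/\Gamma$ compact; write $\gamma=b+B$ for the isometry $x\mapsto b+Bx$. For a subgroup $\mathrm H$ of a space group, $\mathrm{Span}(\mathrm H)$ is the linear span of all $a$ with $a+I\in \mathrm H$. A normal subgroup $\mathrm N$ of $\Gamma$, with $V=\mathrm{Span}(\mathrm N)$, is complete if $\mathrm N=\{a+A\in\Gamma : a\in V,\ V^\perp\subseteq \mathrm{Fix}(A)\}$. For $\gamma=b+B\in\Gamma$ let $\overline\gamma=\overline b+\overline B$ be the isometry of $V$ formed by the orthogonal projection $\overline b$ of $b$ to $V$ and the restriction $\overline B$ of $B$ to $V$; put $\overline{\mathrm N}=\{\overline\nu:\nu\in \mathrm N\}$ and $V/\mathrm N=V/\overline{\mathrm N}$. If $\sigma$ is an affinity between two such spaces that conjugates one group $\overline{\mathrm N}$ to the other, $\sigma_\star$ is the induced map of orbit spaces. Let $\Xi:\Gamma/\mathrm N\to\mathrm{Isom}(V/\mathrm N)$, $\Xi(\mathrm N\gamma)=\overline\gamma_\star$. Let $\mathcal O:\Gamma/\mathrm N\to\mathrm{Out}(\mathrm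 N)$ be induced by conjugation. Let $\mathcal C$ be the centralizer of $\overline{\mathrm N}$ in $\mathrm{Aff}(V)$, which is $\{v+\overline I: v\in\mathrm{Span}(Z(\mathrm N))\}$; let $\mathcal K=\{(v+\overline I)_\star : v\in\mathrm{Span}(Z(\mathrm N))\}$ (the identity component of $\mathrm{Isom}(V/\mathrm N)$); $\Gamma/\mathrm N$ acts by $\mathrm N(b+B)\cdot(v+\overline I)=\overline Bv+\overline I$ on $\mathcal C$ and likewise on $\mathcal K$; and $\kappa:\mathcal C\to\mathcal K$, $\kappa(v+\overline I)=(v+\overline I)_\star$, induces $\kappa_*:H^1(\Gamma/\mathrm N,\mathcal C)\to H^1(\Gamma/\mathrm N,\mathcal K)$. Let $0<m<n$, let $\mathrm M$ be an $m$-space group and $\Delta$ an $(n-m)$-space group. Let $\mathrm{Iso}(\Delta,\mathrm M)$ be the set of isomorphism classes $[\Gamma,\mathrm N]$ of pairs where $\mathrm N$ is a complete normal subgroup of an $n$-space group $\Gamma$ with $\mathrm N\cong \mathrm M$ and $\Gamma/\mathrm N\cong\Delta$; pairs are isomorphic if some isomorphism $\Gamma_1\to\Gamma_2$ maps $\mathrm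 N_1$ onto $\mathrm N_2$. For an isomorphism $\alpha$ of groups, let $\alpha_\#$ be the induced isomorphism of outer automorphism groups, $\alpha_\#(\zeta\,\mathrm{Inn})=\alpha\zeta\alpha^{-1}\mathrm{Inn}$. Let $\mathrm{Out}(\Delta,\mathrm M)$ be the set of homomorphisms $\Delta\to\mathrm{Out}(\mathrm M)$ with finite image, modulo conjugation in $\mathrm{Out}(\mathrm M)$ and composition with $\mathrm{Aut}(\Delta)$, and let $\omega:\mathrm{Iso}(\Delta,\mathrm M)\to\mathrm{Out}(\Delta,\mathrm M)$ be $\omega([\Gamma,\mathrm N])=[\alpha_\#\mathcal O\beta]$ for any isomorphisms $\alpha:\mathrm N\to \mathrm M$, $\beta:\Delta\to\Gamma/\mathrm N$. Given pairs $(\Gamma,\mathrm N)$, $(\Gamma_i,\mathrm N_i)$ (with associated $V_i$, $\Xi_i$, $\mathcal O_i$) and isomorphisms $\alpha_i:\mathrm N\to \mathrm N_i$, $\beta_i:\Gamma/\mathrm N\to\Gamma_i/\mathrm N_i$ with $\mathcal O=(\alpha_i)_\#^{-1}\mathcal O_i\beta_i$, let $\tilde\alpha_i:V\to V_i$ be an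 affinity with $\tilde\alpha_i\overline\nu\tilde\alpha_i^{-1}=\overline{\alpha_i(\nu)}$ for all $\nu\in \mathrm N$; the fiber cohomology class $[\Gamma,\mathrm N;\Gamma_i,\mathrm N_i;\alpha_i,\beta_i]\in H^1(\Gamma/\mathrm N,\mathcal K)$ is the class of the crossed homomorphism $g\mapsto (\tilde\alpha_i)_\star^{-1}\,\Xi_i(\beta_i(g))\,(\tilde\alpha_i)_\star\,\Xi(g)^{-1}$. **Lemma 7.** Let $[\Gamma,\mathrm N]$, $[\Gamma_1,\mathrm N_1]$, $[\Gamma_2,\mathrm N_2]$ be in $\mathrm{Iso}(\Delta,\mathrm M)$. Suppose that $\omega([\Gamma,\mathrm N])=\omega([\Gamma_1,\mathrm N_1])$ with $\mathcal O=(\alpha_1)_\#^{-1}\mathcal O_1\beta_1$ and that $\omega([\Gamma,\mathrm N])=\omega([\Gamma_2,\mathrm N_2])$ with $\mathcal O=(\alpha_2)_\#^{-1}\mathcal O_2\beta_2$. If the classes $[\Gamma,\mathrm N;\Gamma_i,\mathrm N_i;\alpha_i,\beta_i]$ for $i=1,2$ are in the same coset of the image of $\kappa_*:H^1(\Gamma/\mathrm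 N,\mathcal C)\to H^1(\Gamma/\mathrm N,\mathcal K)$ in $H^1(\Gamma/\mathrm N,\mathcal K)$, then $[\Gamma_1,\mathrm N_1]=[\Gamma_2,\mathrm N_2]$. -/

import Mathlib

namespace SpaceGroups

/-! ### Isometries, affinities and space groups -/

/-- Euclidean `n`-space `Eⁿ`. -/
abbrev E (n : ℕ) : Type := EuclideanSpace ℝ (Fin n)

/-- The group `Isom(Eⁿ)`. An element is written `γ = b + B` with `b = γ 0` and `B = lin γ`. -/
abbrev Isom (n : ℕ) : Type := E n ≃ᵃⁱ[ℝ] E n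

/-- The orthogonal part `B` of the isometry `b + B`. -/
noncomputable abbrev lin {n : ℕ} (γ : Isom n) : E n ≃ₗᵢ[ℝ] E n := γ.linearIsometryEquiv

/-- The translation `a + I` of `Eⁿ`. -/
noncomputable abbrev transl {n : ℕ} (a : E n) : Isom n := AffineIsometryEquiv.constVAdd ℝ (E n) a

/-- The usual topology of `Isom(Eⁿ)`: the isometry `b + B` is identified with the pair `(b, B)`
formed by a vector and a linear operator. -/
noncomputable instance isomTopology (n : ℕ) : TopologicalSpace (Isom n) :=
  TopologicalSpace.induced
    (fun γ => (γ 0, ((lin γ).toContinuousLinearEquiv : E n →L[ℝ] E n))) inferInstance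

/-- Isometries act on `Eⁿ` by evaluation. -/
noncomputable instance isomAction (n : ℕ) : MulAction (Isom n) (E n) where
  smul γ x := γ x
  one_smul _ := rfl
  mul_smul _ _ _ := rfl

/-- An `n`-space group (`n`-dimensional crystallographic group): a discrete group of isometries of
`Eⁿ` whose orbit space is compact. -/
def IsSpaceGroup {n : ℕ} (Γ : Subgroup (Isom n)) : Prop :=
  DiscreteTopology Γ ∧ CompactSpace (Quotient (MulAction.orbitRel Γ (E n)))

/-- `Span(H)`: the linear span of all `a` such that the translation `a + I` is in `H`. -/
noncomputable def Span {n : ℕ} (H : Subgroup (Isom n)) : Submodule ℝ (E n) :=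
  Submodule.span ℝ {a | transl a ∈ H}

/-- A pair `(Γ, N)`: an `n`-space group `Γ` and a complete normal subgroup `N` of `Γ`; complete
means `N = {a + A ∈ Γ : a ∈ V, V^⊥ ⊆ Fix(A)}`, where `V = Span(N)`. -/
structure Pair (n : ℕ) where
  /-- the space group `Γ` -/
  Γ : Subgroup (Isom n)
  /-- the normal subgroup `N` of `Γ` -/
  N : Subgroup Γ
  isSpaceGroup : IsSpaceGroup Γ
  normal : N.Normal
  complete : ∀ γ : Γ, γ ∈ N ↔ (γ : Isom n) 0 ∈ Span (N.map Γ.subtype) ∧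
    ∀ x ∈ (Span (N.map Γ.subtype))ᗮ, lin (γ : Isom n) x = x

attribute [instance] Pair.normal

namespace Pair

variable {n : ℕ} (p : Pair n)

/-- `V = Span(N)`. -/
noncomputable def V : Submodule ℝ (E n) := Span (p.N.map p.Γ.subtype)

/-- `Span(Z(N))`, where `Z(N)` is the centre of `N`. -/
noncomputable def SpanZ : Submodule ℝ (E n) :=
  Span (((Subgroup.center p.N).map p.N.subtype).map p.Γ.subtype)

theorem isom_apply (γ : Isom n) (x : E n) : γ x = γ 0 + lin γ x := by
  have := γ.map_vadd 0 x
  simpa [add_comm] using this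

theorem lin_mul (γ δ : Isom n) (x : E n) : lin (γ * δ) x = lin γ (lin δ x) := by
  have h1 := isom_apply (γ * δ) x
  have h2 : (γ * δ) x = γ (δ x) := rfl
  have h3 : (γ * δ) 0 = γ (δ 0) := rfl
  rw [h2, h3, isom_apply γ (δ x), isom_apply γ (δ 0), isom_apply δ x, map_add] at h1
  have : γ 0 + lin γ (δ 0) + lin (γ * δ) x = γ 0 + lin γ (δ 0) + lin γ (lin δ x) := by
    rw [← h1]; abel
  exact add_left_cancel this

theorem lin_one (x : E n) : lin (1 : Isom n) x = x := by
  have h1 := isom_apply (1 : Isom n) x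
  simpa using h1.symm

theorem lin_transl (a x : E n) : lin (transl a) x = x := by
  have h1 := isom_apply (transl a) x
  simpa using h1.symm

theorem isom_ext {γ δ : Isom n} (h0 : γ 0 = δ 0) (h : ∀ x, lin γ x = lin δ x) : γ = δ := by
  ext1 x
  rw [isom_apply γ, isom_apply δ, h0, h]

/-- Conjugation of a translation: `(b + B)(a + I)(b + B)⁻¹ = Ba + I`. -/
theorem conj_transl (γ : Isom n) (a : E n) : γ * transl a * γ⁻¹ = transl (lin γ a) := by
  rw [mul_inv_eq_iff_eq_mul]
  ext1 x
  have e1 : (γ * transl a) x = γ (a + x) := rfl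
  have e2 : (transl (lin γ a) * γ) x = lin γ a + γ x := rfl
  rw [e1, e2, isom_apply γ (a + x), isom_apply γ x, map_add]
  abel

theorem mem_V_of_transl {ν : p.Γ} (hν : ν ∈ p.N) {a : E n} (h : (ν : Isom n) = transl a) :
    a ∈ p.V := by
  refine Submodule.subset_span ?_
  exact ⟨ν, hν, h⟩

theorem lin_mem (γ : p.Γ) {v : E n} (hv : v ∈ p.V) : lin (γ : Isom n) v ∈ p.V := by
  refine Submodule.span_induction (p := fun v _ => lin (γ : Isom n) v ∈ p.V) ?_ ?_ ?_ ?_ hv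
  · rintro a ⟨ν, hν, h⟩
    refine p.mem_V_of_transl (p.normal.conj_mem ν hν γ) ?_
    have h' : (ν : Isom n) = transl a := h
    simp only [Subgroup.coe_mul, Subgroup.coe_inv, h', conj_transl]
  · simp
  · intro x y _ _ hx hy; rw [map_add]; exact add_mem hx hy
  · intro c x _ hx; rw [map_smul]; exact p.V.smul_mem c hx

theorem lin_inv_apply (γ : Isom n) (x : E n) : lin γ⁻¹ (lin γ x) = x := by
  rw [← lin_mul, inv_mul_cancel, lin_one]

theorem lin_apply_inv (γ : Isom n) (x : E n) : lin γ (lin γ⁻¹ x) = x := by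
  rw [← lin_mul, mul_inv_cancel, lin_one]

theorem lin_mem_orthogonal (γ : p.Γ) {w : E n} (hw : w ∈ p.Vᗮ) : lin (γ : Isom n) w ∈ p.Vᗮ := by
  rw [Submodule.mem_orthogonal] at hw ⊢
  intro u hu
  have h := hw _ (p.lin_mem γ⁻¹ hu)
  rw [← (lin (γ : Isom n)).inner_map_map, Subgroup.coe_inv, lin_apply_inv] at h
  exact h

/-- `B̄`, the restriction of `B` to `V`, for `b + B` in `Γ`; a homomorphism `Γ → GL(V)`. -/
noncomputable def rot : p.Γ →* (p.V ≃ₗ[ℝ] p.V) where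
  toFun γ :=
    { toFun := fun v => ⟨lin (γ : Isom n) v, p.lin_mem γ v.2⟩
      map_add' := fun v w => Subtype.ext (by simp)
      map_smul' := fun c v => Subtype.ext (by simp)
      invFun := fun v => ⟨lin ((γ⁻¹ : p.Γ) : Isom n) v, p.lin_mem γ⁻¹ v.2⟩
      left_inv := fun v => Subtype.ext (lin_inv_apply (γ : Isom n) v)
      right_inv := fun v => Subtype.ext (lin_apply_inv (γ : Isom n) v) }
  map_one' := by
    ext v : 2
    exact lin_one (v : E n)
  map_mul' γ δ := by
    ext v : 2
    exact lin_mul (γ : Isom n) δ v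

@[simp] theorem coe_rot (γ : p.Γ) (v : p.V) : (p.rot γ v : E n) = lin (γ : Isom n) v := rfl

/-- `b̄`, the orthogonal projection to `V` of the vector `b`, for `b + B` in `Γ`. -/
noncomputable def vec (γ : p.Γ) : p.V := p.V.orthogonalProjectionOnto ((γ : Isom n) 0)

theorem proj_lin (γ : p.Γ) (x : E n) :
    p.V.orthogonalProjectionOnto (lin (γ : Isom n) x)
      = p.rot γ (p.V.orthogonalProjectionOnto x) := by
  have hx : x - p.V.orthogonalProjectionOnto x ∈ p.Vᗮ :=
    p.V.sub_starProjection_mem_orthogonal x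
  have h1 : lin (γ : Isom n) x = (p.rot γ (p.V.orthogonalProjectionOnto x) : E n)
      + lin (γ : Isom n) (x - p.V.orthogonalProjectionOnto x) := by
    rw [coe_rot, ← map_add]; congr 1; abel
  rw [h1, map_add, Submodule.orthogonalProjectionOnto_mem_subspace_eq_self,
    Submodule.orthogonalProjectionOnto_apply_of_mem_orthogonal
      (p.lin_mem_orthogonal γ hx), add_zero]

theorem vec_mul (γ δ : p.Γ) : p.vec (γ * δ) = p.vec γ + p.rot γ (p.vec δ) := by
  have h : ((γ * δ : p.Γ) : Isom n) 0 = (γ : Isom n) 0 + lin (γ : Isom n) ((δ : Isom n) 0) :=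
    isom_apply (γ : Isom n) _
  rw [vec, h, map_add, proj_lin]; rfl

/-- `γ̄ = b̄ + B̄`, an isometry of `V`, for `γ = b + B` in `Γ`; a homomorphism from `Γ` to the
group `Aff(V)` of affinities of `V`. -/
noncomputable def bar : p.Γ →* (p.V ≃ᵃ[ℝ] p.V) where
  toFun γ := (p.rot γ).toAffineEquiv.trans (AffineEquiv.constVAdd ℝ p.V (p.vec γ))
  map_one' := by
    ext1 v
    have h : p.vec 1 = 0 := by simp [vec]
    simp [h]
  map_mul' γ δ := by
    ext1 v
    simp [vec_mul]

theorem bar_apply (γ : p.Γ) (v : p.V) : p.bar γ v = p.vec γ + p.rot γ v := rfl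

/-- The group `N̄ = {ν̄ : ν ∈ N}`. -/
noncomputable def Nbar : Subgroup (p.V ≃ᵃ[ℝ] p.V) := p.N.map p.bar

end Pair

namespace Pair

variable {n : ℕ} (p : Pair n)

/-! ### The translation lattice of `N` and the finiteness of the point group -/

theorem mem_N_iff (γ : p.Γ) : γ ∈ p.N ↔ (γ : Isom n) 0 ∈ p.V ∧
    ∀ x ∈ p.Vᗮ, lin (γ : Isom n) x = x := p.complete γ

theorem coe_vec_of_mem {ν : p.Γ} (hν : ν ∈ p.N) : (p.vec ν : E n) = (ν : Isom n) 0 :=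
  congrArg Subtype.val (Submodule.orthogonalProjectionOnto_mem_subspace_eq_self
    (⟨(ν : Isom n) 0, ((p.mem_N_iff ν).1 hν).1⟩ : p.V))

theorem ext_of_mem {μ ν : p.Γ} (hμ : μ ∈ p.N) (hν : ν ∈ p.N) (hv : p.vec μ = p.vec ν)
    (hr : p.rot μ = p.rot ν) : μ = ν := by
  apply Subtype.ext
  refine isom_ext ?_ fun x => ?_
  · rw [← p.coe_vec_of_mem hμ, ← p.coe_vec_of_mem hν, hv]
  · have hx : x = (p.V.orthogonalProjectionOnto x : E n) + (x - p.V.orthogonalProjectionOnto x) := by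
      abel
    have hx' : x - p.V.orthogonalProjectionOnto x ∈ p.Vᗮ :=
      p.V.sub_starProjection_mem_orthogonal x
    rw [hx, map_add, map_add, ((p.mem_N_iff μ).1 hμ).2 _ hx', ((p.mem_N_iff ν).1 hν).2 _ hx']
    congr 1
    have := congrArg (fun e => ((e (p.V.orthogonalProjectionOnto x) : p.V) : E n)) hr
    simpa using this

theorem bar_injOn {μ ν : p.Γ} (hμ : μ ∈ p.N) (hν : ν ∈ p.N) (h : p.bar μ = p.bar ν) : μ = ν := by
  have h0 : p.vec μ = p.vec ν := by
    have := congrArg (fun e => e (0 : p.V)) h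
    simpa [bar_apply] using this
  refine p.ext_of_mem hμ hν h0 ?_
  ext1 v
  have := congrArg (fun e => e v) h
  simpa [bar_apply, h0] using this

theorem transl_add (a b : E n) : transl (a + b) = transl a * transl b := by
  ext1 x
  exact add_assoc a b x

theorem transl_zero : transl (0 : E n) = 1 := by
  ext1 x
  exact zero_add x

theorem transl_neg (a : E n) : transl (-a) = (transl a)⁻¹ := by
  rw [eq_inv_iff_mul_eq_one, ← transl_add, neg_add_cancel, transl_zero]

/-- The lattice `{a ∈ V : a + I ∈ N}` of the translations in `N`. -/
noncomputable def L : Submodule ℤ p.V := AddSubgroup.toIntSubmodule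
  { carrier := {v | ∃ ν ∈ p.N, (ν : Isom n) = transl (v : E n)}
    zero_mem' := ⟨1, p.N.one_mem, transl_zero.symm⟩
    add_mem' := by
      rintro a b ⟨μ, hμ, h⟩ ⟨ν, hν, h'⟩
      exact ⟨μ * ν, p.N.mul_mem hμ hν, by rw [Subgroup.coe_mul, h, h', Submodule.coe_add, transl_add]⟩
    neg_mem' := by
      rintro a ⟨μ, hμ, h⟩
      exact ⟨μ⁻¹, p.N.inv_mem hμ, by rw [Subgroup.coe_inv, h, Submodule.coe_neg, transl_neg]⟩ }

theorem mem_L {v : p.V} : v ∈ p.L ↔ ∃ ν ∈ p.N, (ν : Isom n) = transl (v : E n) := Iff.rfl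

theorem rot_mem_L (γ : p.Γ) {v : p.V} (hv : v ∈ p.L) : p.rot γ v ∈ p.L := by
  obtain ⟨ν, hν, h⟩ := hv
  refine ⟨γ * ν * γ⁻¹, p.normal.conj_mem ν hν γ, ?_⟩
  simp only [Subgroup.coe_mul, Subgroup.coe_inv, h, conj_transl, coe_rot]

theorem vec_mem_L {ν : p.Γ} (hν : ν ∈ p.N) (h : p.rot ν = 1) : p.vec ν ∈ p.L := by
  refine ⟨ν, hν, isom_ext ?_ fun x => ?_⟩
  · rw [p.coe_vec_of_mem hν]; simp
  · rw [lin_transl]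
    have hx : x = (p.V.orthogonalProjectionOnto x : E n) + (x - p.V.orthogonalProjectionOnto x) := by
      abel
    have hx' : x - p.V.orthogonalProjectionOnto x ∈ p.Vᗮ :=
      p.V.sub_starProjection_mem_orthogonal x
    have h2 := congrArg (fun e => ((e (p.V.orthogonalProjectionOnto x) : p.V) : E n)) h
    simp only [coe_rot] at h2
    rw [hx, map_add, ((p.mem_N_iff ν).1 hν).2 _ hx', h2]
    rfl

theorem rot_eq_one_of_transl {ν : p.Γ} {a : E n} (h : (ν : Isom n) = transl a) : p.rot ν = 1 := by
  ext v
  rw [coe_rot, h, lin_transl]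
  rfl

theorem vec_of_transl {ν : p.Γ} {v : p.V} (h : (ν : Isom n) = transl (v : E n)) : p.vec ν = v := by
  rw [vec, h]
  simp

instance discrete_L : DiscreteTopology p.L := by
  have hΓ : DiscreteTopology p.Γ := p.isSpaceGroup.1
  have hmem : ∀ v : p.L, transl ((v : p.V) : E n) ∈ p.Γ := by
    rintro ⟨v, ν, _, h⟩
    rw [← h]; exact ν.2
  refine DiscreteTopology.of_continuous_injective
    (f := fun v : p.L => (⟨transl ((v : p.V) : E n), hmem v⟩ : p.Γ)) ?_ ?_
  · refine Continuous.subtype_mk (continuous_induced_rng.2 ?_) _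
    refine Continuous.prodMk ?_ ?_
    · change Continuous fun v : p.L => (transl ((v : p.V) : E n)) 0
      have : ∀ v : p.L, (transl ((v : p.V) : E n)) 0 = ((v : p.V) : E n) := by intro v; simp
      simp only [this]
      fun_prop
    · have : ∀ v : p.L, ((lin (transl ((v : p.V) : E n))).toContinuousLinearEquiv : E n →L[ℝ] E n)
          = ContinuousLinearMap.id ℝ (E n) := by
        intro v; ext1 x; exact lin_transl ((v : p.V) : E n) x
      simp only [this]
      exact continuous_const
  · intro v w h
    have := congrArg (fun γ : p.Γ => (γ : Isom n) 0) h
    apply Subtype.ext; apply Subtype.ext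
    simpa using this

theorem span_L : Submodule.span ℝ (p.L : Set p.V) = ⊤ := by
  rw [eq_top_iff]
  rintro ⟨v, hv⟩ -
  suffices h : ∃ h : v ∈ p.V, (⟨v, h⟩ : p.V) ∈ Submodule.span ℝ (p.L : Set p.V) from h.2
  refine Submodule.span_induction
    (p := fun v _ => ∃ h : v ∈ p.V, (⟨v, h⟩ : p.V) ∈ Submodule.span ℝ (p.L : Set p.V))
    ?_ ?_ ?_ ?_ hv
  · rintro a ⟨ν, hν, h⟩
    have h' : (ν : Isom n) = transl a := h
    exact ⟨p.mem_V_of_transl hν h', Submodule.subset_span ⟨ν, hν, h'⟩⟩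
  · exact ⟨p.V.zero_mem, Submodule.zero_mem _⟩
  · rintro x y _ _ ⟨hx, hx'⟩ ⟨hy, hy'⟩
    exact ⟨p.V.add_mem hx hy, Submodule.add_mem _ hx' hy'⟩
  · rintro c x _ ⟨hx, hx'⟩
    exact ⟨p.V.smul_mem c hx, Submodule.smul_mem _ c hx'⟩

instance zlattice_L : IsZLattice ℝ p.L := ⟨p.span_L⟩

/-- Two linear maps on `V` that agree on the lattice are equal. -/
theorem linear_ext {W : Type*} [AddCommGroup W] [Module ℝ W] {f g : p.V →ₗ[ℝ] W}
    (h : ∀ v ∈ p.L, f v = g v) : f = g :=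
  LinearMap.ext_on p.span_L h

instance finite_rot : Finite p.rot.range := by
  let b := (Module.Free.chooseBasis ℤ p.L)
  let c := b.ofZLatticeBasis ℝ p.L
  have hc : ∀ i, c i ∈ p.L := fun i => by
    rw [b.ofZLatticeBasis_apply ℝ p.L]; exact (b i).2
  have hfin : ∀ i, (Metric.closedBall (0 : p.V) ‖c i‖ ∩ (p.L : Set p.V)).Finite := fun i => by
    have hd : DiscreteTopology p.L.toAddSubgroup := p.discrete_L
    refine Metric.finite_isBounded_inter_isClosed ⟨p.discrete_L⟩ Metric.isBounded_closedBall ?_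
    exact AddSubgroup.isClosed_of_discrete (H := p.L.toAddSubgroup)
  have hpi := Set.Finite.pi hfin
  have : Finite ↥(Set.pi Set.univ fun i => Metric.closedBall (0 : p.V) ‖c i‖ ∩ (p.L : Set p.V)) := hpi
  refine Finite.of_injective
    (β := ↥(Set.pi Set.univ fun i => Metric.closedBall (0 : p.V) ‖c i‖ ∩ (p.L : Set p.V)))
    (fun A => ⟨fun i => (A : p.V ≃ₗ[ℝ] p.V) (c i), ?_⟩) ?_
  · obtain ⟨A, γ, rfl⟩ := A
    intro i _
    refine ⟨?_, p.rot_mem_L γ (hc i)⟩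
    rw [mem_closedBall_zero_iff]
    exact ((lin (γ : Isom n)).norm_map _).le
  · intro A B h
    apply Subtype.ext
    apply LinearEquiv.toLinearMap_injective
    refine c.ext fun i => ?_
    exact congrFun (congrArg Subtype.val h) i

/-- The point group of `N̄`. -/
noncomputable def P : Subgroup (p.V ≃ₗ[ℝ] p.V) := p.N.map p.rot

instance finite_P : Finite p.P := by
  have h : (p.P : Set (p.V ≃ₗ[ℝ] p.V)) ⊆ p.rot.range := by
    rintro _ ⟨ν, _, rfl⟩; exact ⟨ν, rfl⟩
  have h2 : (p.rot.range : Set (p.V ≃ₗ[ℝ] p.V)).Finite := p.finite_rot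
  exact h2.subset h

noncomputable instance fintype_P : Fintype p.P := Fintype.ofFinite _

/-- The sum over the point group of `N̄`. -/
noncomputable def tr : p.V →ₗ[ℝ] p.V := ∑ A : p.P, ((A : p.V ≃ₗ[ℝ] p.V) : p.V →ₗ[ℝ] p.V)

theorem tr_apply (v : p.V) : p.tr v = ∑ A : p.P, (A : p.V ≃ₗ[ℝ] p.V) v := by
  simp [tr]

theorem rot_tr {ν : p.Γ} (hν : ν ∈ p.N) (v : p.V) : p.rot ν (p.tr v) = p.tr v := by
  rw [tr_apply, map_sum]
  exact Fintype.sum_equiv (Equiv.mulLeft (⟨p.rot ν, ν, hν, rfl⟩ : p.P)) _ _ fun A => rfl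

theorem tr_mem_L {v : p.V} (hv : v ∈ p.L) : p.tr v ∈ p.L := by
  rw [tr_apply]
  refine Submodule.sum_mem _ ?_
  rintro ⟨_, ν, _, rfl⟩ _
  exact p.rot_mem_L ν hv

theorem tr_of_fixed {v : p.V} (h : ∀ ν ∈ p.N, p.rot ν v = v) :
    p.tr v = (Fintype.card p.P : ℝ) • v := by
  rw [tr_apply]
  have : ∀ A : p.P, (A : p.V ≃ₗ[ℝ] p.V) v = v := by
    rintro ⟨_, ν, hν, rfl⟩; exact h ν hν
  simp [this, Nat.cast_smul_eq_nsmul]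

theorem card_P_ne_zero : (Fintype.card p.P : ℝ) ≠ 0 := by
  exact_mod_cast Fintype.card_ne_zero

theorem SpanZ_le : p.SpanZ ≤ p.V := by
  refine Submodule.span_mono ?_
  rintro a ⟨_, ⟨ν, _, rfl⟩, h⟩
  exact ⟨_, ν.2, h⟩

theorem transl_mem_SpanZ {v : p.V} (hv : v ∈ p.L) (h : ∀ ν ∈ p.N, p.rot ν v = v) :
    (v : E n) ∈ p.SpanZ := by
  obtain ⟨τ, hτ, hτ'⟩ := hv
  refine Submodule.subset_span ⟨τ, ⟨⟨τ, hτ⟩, ?_, rfl⟩, hτ'⟩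
  rw [SetLike.mem_coe, Subgroup.mem_center_iff]
  rintro ⟨ν, hν⟩
  apply Subtype.ext; apply Subtype.ext
  simp only [Subgroup.coe_mul]
  rw [hτ', ← mul_inv_eq_iff_eq_mul, conj_transl, ← coe_rot, h ν hν]

/-- `Span(Z(N))` is the set of all vectors of `V` that are fixed by the point group of `N`. -/
theorem mem_SpanZ_iff (v : p.V) : (v : E n) ∈ p.SpanZ ↔ ∀ ν ∈ p.N, p.rot ν v = v := by
  constructor
  · intro hv ν hν
    apply Subtype.ext
    rw [coe_rot]
    refine Submodule.span_induction (p := fun v _ => lin (ν : Isom n) v = v) ?_ ?_ ?_ ?_ hv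
    · rintro a ⟨_, ⟨τ, hτ, rfl⟩, h⟩
      have h1 := Subgroup.mem_center_iff.1 hτ ⟨ν, hν⟩
      have h2 : (ν : Isom n) * transl a = transl a * (ν : Isom n) := by
        have h3 := congrArg (fun x : p.N => ((x : p.Γ) : Isom n)) h1
        simp only [Subgroup.coe_mul] at h3
        have h' : ((τ : p.Γ) : Isom n) = transl a := h
        rwa [h'] at h3
      have h4 := conj_transl (ν : Isom n) a
      rw [h2, mul_inv_cancel_right] at h4
      have := congrArg (fun γ : Isom n => γ 0) h4
      simpa using this.symm
    · simp
    · intro x y _ _ hx hy; rw [map_add, hx, hy]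
    · intro c x _ hx; rw [map_smul, hx]
  · intro h
    have key : ∀ w : p.V, (p.tr w : E n) ∈ p.SpanZ := by
      intro w
      have hw : w ∈ Submodule.span ℝ (p.L : Set p.V) := by rw [span_L]; trivial
      refine Submodule.span_induction (p := fun w _ => (p.tr w : E n) ∈ p.SpanZ) ?_ ?_ ?_ ?_ hw
      · intro a ha
        exact p.transl_mem_SpanZ (p.tr_mem_L ha) fun ν hν => p.rot_tr hν a
      · simp
      · intro x y _ _ hx hy; rw [map_add]; exact add_mem hx hy
      · intro c x _ hx; rw [map_smul]; exact Submodule.smul_mem _ c hx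
    have h1 := key v
    rw [p.tr_of_fixed h] at h1
    exact (Submodule.smul_mem_iff _ p.card_P_ne_zero).1 h1

end Pair

/-! ### Orbit spaces, and the bijections between them induced by affinities -/

section Orbit

variable {W W₁ W₂ W₃ : Type*} [AddCommGroup W] [Module ℝ W] [AddCommGroup W₁] [Module ℝ W₁]
  [AddCommGroup W₂] [Module ℝ W₂] [AddCommGroup W₃] [Module ℝ W₃]

/-- Affinities of a vector space act on it by evaluation. -/
instance affAction : MulAction (W ≃ᵃ[ℝ] W) W where
  smul e x := e x
  one_smul _ := rfl
  mul_smul _ _ _ := rfl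

/-- The orbit space `W/H` of a group `H` of affinities of `W`. -/
abbrev Orb (H : Subgroup (W ≃ᵃ[ℝ] W)) : Type _ := Quotient (MulAction.orbitRel H W)

/-- `e_* : Aff(W₁) → Aff(W₂)`, `e_*(g) = e g e⁻¹`, for an affinity `e : W₁ → W₂`. -/
def conjAff (e : W₁ ≃ᵃ[ℝ] W₂) : (W₁ ≃ᵃ[ℝ] W₁) ≃* (W₂ ≃ᵃ[ℝ] W₂) where
  toFun g := e.symm.trans (g.trans e)
  invFun g := e.trans (g.trans e.symm)
  left_inv g := by ext x; simp
  right_inv g := by ext x; simp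
  map_mul' g h := by ext x; simp

theorem conjAff_apply (e : W₁ ≃ᵃ[ℝ] W₂) (g : W₁ ≃ᵃ[ℝ] W₁) (x : W₂) :
    conjAff e g x = e (g (e.symm x)) := rfl

theorem conjAff_self (e g : W ≃ᵃ[ℝ] W) : conjAff e g = e * g * e⁻¹ := rfl

/-- `e H₁ e⁻¹ = H₂`. -/
def Carries (e : W₁ ≃ᵃ[ℝ] W₂) (H₁ : Subgroup (W₁ ≃ᵃ[ℝ] W₁)) (H₂ : Subgroup (W₂ ≃ᵃ[ℝ] W₂)) : Prop :=
  H₁.map (conjAff e).toMonoidHom = H₂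

theorem Carries.orbit_iff {e : W₁ ≃ᵃ[ℝ] W₂} {H₁ : Subgroup (W₁ ≃ᵃ[ℝ] W₁)}
    {H₂ : Subgroup (W₂ ≃ᵃ[ℝ] W₂)} (h : Carries e H₁ H₂) (x y : W₁) :
    (MulAction.orbitRel H₁ W₁) x y ↔ (MulAction.orbitRel H₂ W₂) (e x) (e y) := by
  subst h
  rw [MulAction.orbitRel_apply, MulAction.orbitRel_apply]
  constructor
  · rintro ⟨⟨g, hg⟩, hgx⟩
    refine ⟨⟨conjAff e g, g, hg, rfl⟩, ?_⟩
    have hgx' : g y = x := hgx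
    change e (g (e.symm (e y))) = e x
    rw [e.symm_apply_apply, hgx']
  · rintro ⟨⟨_, g, hg, rfl⟩, hgx⟩
    refine ⟨⟨g, hg⟩, ?_⟩
    have hgx' : e (g (e.symm (e y))) = e x := hgx
    rw [e.symm_apply_apply] at hgx'
    exact e.injective hgx'

/-- `e_⋆ : W₁/H₁ → W₂/H₂`, `e_⋆(H₁ x) = H₂ e(x)`, for an affinity `e` with `e H₁ e⁻¹ = H₂`. -/
def star (e : W₁ ≃ᵃ[ℝ] W₂) {H₁ : Subgroup (W₁ ≃ᵃ[ℝ] W₁)} {H₂ : Subgroup (W₂ ≃ᵃ[ℝ] W₂)}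
    (h : Carries e H₁ H₂) : Orb H₁ ≃ Orb H₂ :=
  Quotient.congr e.toEquiv h.orbit_iff

theorem star_mk (e : W₁ ≃ᵃ[ℝ] W₂) {H₁ : Subgroup (W₁ ≃ᵃ[ℝ] W₁)} {H₂ : Subgroup (W₂ ≃ᵃ[ℝ] W₂)}
    (h : Carries e H₁ H₂) (x : W₁) :
    star e h (Quotient.mk _ x) = Quotient.mk _ (e x) := rfl

end Orbit

namespace Pair

variable {n : ℕ} (p : Pair n)

/-- The orbit space `V/N`. -/
abbrev OrbV : Type := Orb p.Nbar

/-- The class `N v` of a vector `v` in `V/N`. -/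
noncomputable def cls (v : p.V) : p.OrbV := Quotient.mk _ v

theorem cls_surjective : Function.Surjective p.cls := Quotient.mk_surjective

theorem carries_bar (γ : p.Γ) : Carries (p.bar γ) p.Nbar p.Nbar := by
  refine le_antisymm ?_ ?_
  · rintro _ ⟨_, ⟨ν, hν, rfl⟩, rfl⟩
    refine ⟨γ * ν * γ⁻¹, p.normal.conj_mem ν hν γ, ?_⟩
    rw [map_mul, map_mul, map_inv]; rfl
  · rintro _ ⟨ν, hν, rfl⟩
    refine ⟨p.bar (γ⁻¹ * ν * γ), ⟨γ⁻¹ * ν * γ, ?_, rfl⟩, ?_⟩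
    · simpa using p.normal.conj_mem ν hν γ⁻¹
    · change conjAff (p.bar γ) _ = _
      rw [conjAff_self, ← map_mul, ← map_inv, ← map_mul]
      congr 1; group

theorem cls_eq_of_mem {ν : p.Γ} (hν : ν ∈ p.N) (v : p.V) : p.cls (p.bar ν v) = p.cls v := by
  refine Quotient.sound ?_
  change MulAction.orbitRel _ _ _ _
  rw [MulAction.orbitRel_apply]
  exact ⟨⟨p.bar ν, ν, hν, rfl⟩, rfl⟩

/-- `Ξ : Γ/N → Isom(V/N)`, `Ξ(Nγ)(N v) = N γ̄(v)`. The group `Isom(V/N)`, and the group `Aff(V/N)`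
of affinities of `V/N`, are regarded as subgroups of the group of all bijections of `V/N`. -/
noncomputable def Xi : p.Γ ⧸ p.N →* Equiv.Perm p.OrbV :=
  QuotientGroup.lift p.N
    { toFun := fun γ => star (p.bar γ) (p.carries_bar γ)
      map_one' := by
        ext x
        obtain ⟨v, rfl⟩ := p.cls_surjective x
        change p.cls (p.bar 1 v) = _
        rw [map_one]; rfl
      map_mul' := fun γ δ => by
        ext x
        obtain ⟨v, rfl⟩ := p.cls_surjective x
        change p.cls (p.bar (γ * δ) v) = p.cls (p.bar γ (p.bar δ v))
        rw [map_mul]; rfl }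
    (by
      intro ν hν
      ext x
      obtain ⟨v, rfl⟩ := p.cls_surjective x
      exact p.cls_eq_of_mem hν v)

theorem Xi_cls (γ : p.Γ) (v : p.V) : p.Xi (QuotientGroup.mk γ) (p.cls v) = p.cls (p.bar γ v) := rfl

/-! ### The modules `𝒞` and `𝒦` -/

/-- `𝒞`: the centralizer of `N̄` in `Aff(V)`. -/
noncomputable def C : Subgroup (p.V ≃ᵃ[ℝ] p.V) := Subgroup.centralizer (p.Nbar : Set (p.V ≃ᵃ[ℝ] p.V))

theorem bar_of_transl {τ : p.Γ} {a : p.V} (h : (τ : Isom n) = transl (a : E n)) (x : p.V) :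
    p.bar τ x = a + x := by
  rw [bar_apply, p.vec_of_transl h, p.rot_eq_one_of_transl h]; rfl

/-- `𝒞 = {v + I : v ∈ Span(Z(N))}`. -/
theorem mem_C_iff (c : p.V ≃ᵃ[ℝ] p.V) :
    c ∈ p.C ↔ ∃ v : p.V, (v : E n) ∈ p.SpanZ ∧ ∀ x, c x = v + x := by
  rw [C, Subgroup.mem_centralizer_iff]
  constructor
  · intro h
    have h' : ∀ ν ∈ p.N, ∀ x, p.bar ν (c x) = c (p.bar ν x) := fun ν hν x =>
      congrArg (fun e : p.V ≃ᵃ[ℝ] p.V => e x) (h _ ⟨ν, hν, rfl⟩)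
    have hlin : ∀ x, c x = c 0 + c.linear x := fun x => by
      have := c.map_vadd 0 x
      simpa [add_comm] using this
    have hL : (c.linear : p.V →ₗ[ℝ] p.V) = LinearMap.id := by
      refine p.linear_ext ?_
      rintro a ⟨τ, hτ, ht⟩
      have h1 := h' τ hτ 0
      rw [p.bar_of_transl ht, p.bar_of_transl ht, hlin (a + 0), add_zero, add_comm] at h1
      exact (add_left_cancel h1).symm
    have hc : ∀ x, c x = c 0 + x := fun x => by
      rw [hlin x]; congr 1
      exact congrArg (fun f : p.V →ₗ[ℝ] p.V => f x) hL
    refine ⟨c 0, ?_, hc⟩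
    rw [mem_SpanZ_iff]
    intro ν hν
    have h1 := h' ν hν 0
    have h2 : p.bar ν 0 = p.vec ν := by rw [bar_apply, map_zero, add_zero]
    rw [h2, hc (p.vec ν), bar_apply, add_comm] at h1
    exact add_right_cancel h1
  · rintro ⟨v, hv, hc⟩ _ ⟨ν, hν, rfl⟩
    rw [mem_SpanZ_iff] at hv
    ext1 x
    change p.bar ν (c x) = c (p.bar ν x)
    rw [hc, hc, bar_apply, bar_apply, map_add, hv ν hν]
    abel

noncomputable instance commGroupC : CommGroup p.C :=
  { (inferInstance : Group p.C) with
    mul_comm := by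
      rintro ⟨c, hc⟩ ⟨d, hd⟩
      obtain ⟨v, -, hv⟩ := (p.mem_C_iff c).1 hc
      obtain ⟨w, -, hw⟩ := (p.mem_C_iff d).1 hd
      apply Subtype.ext
      ext1 x
      change c (d x) = d (c x)
      rw [hv, hw, hw, hv]
      abel }

/-- `𝒦 = {(v + I)_⋆ : v ∈ Span(Z(N))}`, where `(v + I)_⋆(N x) = N (v + x)`; this group is the
connected component of the identity of the Lie group `Isom(V/N)`. -/
noncomputable def K : Subgroup (Equiv.Perm p.OrbV) where
  carrier := {k | ∃ v : p.V, (v : E n) ∈ p.SpanZ ∧ ∀ x, k (p.cls x) = p.cls (v + x)}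
  one_mem' := ⟨0, by simp, fun x => by rw [zero_add]; rfl⟩
  mul_mem' := by
    rintro k l ⟨v, hv, hk⟩ ⟨w, hw, hl⟩
    refine ⟨v + w, p.SpanZ.add_mem hv hw, fun x => ?_⟩
    rw [Equiv.Perm.mul_apply, hl, hk, add_assoc]
  inv_mem' := by
    rintro k ⟨v, hv, hk⟩
    refine ⟨-v, p.SpanZ.neg_mem hv, fun x => ?_⟩
    rw [Equiv.Perm.inv_eq_iff_eq, hk, add_neg_cancel_left]

noncomputable instance commGroupK : CommGroup p.K :=
  { (inferInstance : Group p.K) with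
    mul_comm := by
      rintro ⟨k, v, -, hk⟩ ⟨l, w, -, hl⟩
      apply Subtype.ext
      ext x
      obtain ⟨x, rfl⟩ := p.cls_surjective x
      change k (l (p.cls x)) = l (k (p.cls x))
      rw [hk, hl, hl, hk, add_left_comm] }

theorem SpanZ_invariant (γ : p.Γ) {v : p.V} (hv : (v : E n) ∈ p.SpanZ) :
    (p.rot γ v : E n) ∈ p.SpanZ := by
  rw [mem_SpanZ_iff] at hv ⊢
  intro ν hν
  have h1 := hv (γ⁻¹ * ν * γ) (by simpa using p.normal.conj_mem ν hν γ⁻¹)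
  have h2 : p.rot ν (p.rot γ v) = p.rot γ (p.rot (γ⁻¹ * ν * γ) v) := by
    have : ν * γ = γ * (γ⁻¹ * ν * γ) := by group
    have h3 := congrArg (fun δ => p.rot δ v) this
    simpa only [map_mul, LinearEquiv.mul_apply] using h3
  rw [h2, h1]

theorem bar_conj (γ : p.Γ) (v x : p.V) :
    p.bar γ (v + p.bar γ⁻¹ x) = p.rot γ v + x := by
  have h1 : p.bar γ (p.bar γ⁻¹ x) = x := by
    have := congrArg (fun e : p.V ≃ᵃ[ℝ] p.V => e x) (map_mul p.bar γ γ⁻¹)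
    rw [mul_inv_cancel, map_one] at this
    exact this.symm
  calc p.bar γ (v + p.bar γ⁻¹ x) = p.rot γ v + p.bar γ (p.bar γ⁻¹ x) := by
        rw [p.bar_apply γ, p.bar_apply γ (p.bar γ⁻¹ x), map_add]; abel
    _ = _ := by rw [h1]

/-- The action of `Γ` on `𝒞` by conjugation. -/
noncomputable def conjC : p.Γ →* MulAut p.C where
  toFun γ :=
    { toFun := fun c => ⟨p.bar γ * c * p.bar γ⁻¹, by
        obtain ⟨v, hv, hc⟩ := (p.mem_C_iff c).1 c.2
        refine (p.mem_C_iff _).2 ⟨p.rot γ v, p.SpanZ_invariant γ hv, fun x => ?_⟩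
        change p.bar γ ((c : p.V ≃ᵃ[ℝ] p.V) (p.bar γ⁻¹ x)) = _
        rw [hc, bar_conj]⟩
      invFun := fun c => ⟨p.bar γ⁻¹ * c * p.bar γ, by
        obtain ⟨v, hv, hc⟩ := (p.mem_C_iff c).1 c.2
        refine (p.mem_C_iff _).2 ⟨p.rot γ⁻¹ v, p.SpanZ_invariant γ⁻¹ hv, fun x => ?_⟩
        change p.bar γ⁻¹ ((c : p.V ≃ᵃ[ℝ] p.V) (p.bar γ x)) = _
        rw [hc]
        have := p.bar_conj γ⁻¹ v x
        rwa [inv_inv] at this⟩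
      left_inv := fun c => Subtype.ext (by simp only [map_inv]; group)
      right_inv := fun c => Subtype.ext (by simp only [map_inv]; group)
      map_mul' := fun c d => Subtype.ext (by simp only [map_inv, Subgroup.coe_mul]; group) }
  map_one' := by
    ext1 c
    exact Subtype.ext (by simp)
  map_mul' γ δ := by
    ext1 c
    exact Subtype.ext (by
      simp only [MulAut.mul_apply, MulEquiv.coe_mk, Equiv.coe_fn_mk, map_mul, map_inv]; group)

theorem conjC_of_mem {ν : p.Γ} (hν : ν ∈ p.N) : p.conjC ν = 1 := by
  ext1 c
  apply Subtype.ext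
  change p.bar ν * c * p.bar ν⁻¹ = c
  have h := Subgroup.mem_centralizer_iff.1 c.2 (p.bar ν) ⟨ν, hν, rfl⟩
  rw [h, map_inv, mul_inv_cancel_right]

/-- The action of `Γ/N` on `𝒞`: `(N γ) • c = γ̄ c γ̄⁻¹`. -/
noncomputable instance actionC : MulDistribMulAction (p.Γ ⧸ p.N) p.C :=
  MulDistribMulAction.compHom p.C
    (QuotientGroup.lift p.N p.conjC fun _ hν => p.conjC_of_mem hν)

/-- The action of `Γ/N` on `𝒞` is `(N(b + B)) • (v + I) = B̄v + I`. -/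
theorem smul_C_apply (γ : p.Γ) (c : p.C) {v : p.V} (hc : ∀ x, (c : p.V ≃ᵃ[ℝ] p.V) x = v + x)
    (x : p.V) :
    (((γ : p.Γ ⧸ p.N) • c : p.C) : p.V ≃ᵃ[ℝ] p.V) x = p.rot γ v + x := by
  change p.bar γ ((c : p.V ≃ᵃ[ℝ] p.V) (p.bar γ⁻¹ x)) = _
  rw [hc, bar_conj]

theorem Xi_conj_apply (γ : p.Γ) {k : Equiv.Perm p.OrbV} {v : p.V}
    (hk : ∀ x, k (p.cls x) = p.cls (v + x)) (x : p.V) :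
    (p.Xi γ * k * (p.Xi γ)⁻¹) (p.cls x) = p.cls (p.rot γ v + x) := by
  have h1 : (p.Xi γ)⁻¹ (p.cls x) = p.cls (p.bar γ⁻¹ x) := by
    rw [← map_inv, ← QuotientGroup.mk_inv]; rfl
  rw [Equiv.Perm.mul_apply, Equiv.Perm.mul_apply, h1, hk, Xi_cls, bar_conj]

/-- The action of `Γ/N` on `𝒦`: `g • k = Ξ(g) k Ξ(g)⁻¹`. -/
noncomputable instance actionK : MulDistribMulAction (p.Γ ⧸ p.N) p.K where
  smul g k := ⟨p.Xi g * k * (p.Xi g)⁻¹, by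
    obtain ⟨γ, rfl⟩ := QuotientGroup.mk_surjective g
    obtain ⟨v, hv, hk⟩ := k.2
    exact ⟨p.rot γ v, p.SpanZ_invariant γ hv, p.Xi_conj_apply γ hk⟩⟩
  one_smul k := Subtype.ext (by change p.Xi 1 * k * (p.Xi 1)⁻¹ = k; simp)
  mul_smul g h k := Subtype.ext (by
    change p.Xi (g * h) * k * (p.Xi (g * h))⁻¹ = p.Xi g * (p.Xi h * k * (p.Xi h)⁻¹) * (p.Xi g)⁻¹
    rw [map_mul]; group)
  smul_mul g k l := Subtype.ext (by
    change p.Xi g * (k * l) * (p.Xi g)⁻¹ = p.Xi g * k * (p.Xi g)⁻¹ * (p.Xi g * l * (p.Xi g)⁻¹)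
    group)
  smul_one g := Subtype.ext (by change p.Xi g * 1 * (p.Xi g)⁻¹ = 1; group)

theorem coe_smul_K (g : p.Γ ⧸ p.N) (k : p.K) :
    ((g • k : p.K) : Equiv.Perm p.OrbV) = p.Xi g * k * (p.Xi g)⁻¹ := rfl

/-- The action of `Γ/N` on `𝒦` is `(N(b + B)) • (v + I)_⋆ = (B̄v + I)_⋆`. -/
theorem smul_K_apply (γ : p.Γ) (k : p.K) {v : p.V}
    (hk : ∀ x, (k : Equiv.Perm p.OrbV) (p.cls x) = p.cls (v + x)) (x : p.V) :
    (((γ : p.Γ ⧸ p.N) • k : p.K) : Equiv.Perm p.OrbV) (p.cls x) = p.cls (p.rot γ v + x) :=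
  p.Xi_conj_apply γ hk x

theorem carries_C (c : p.C) : Carries (c : p.V ≃ᵃ[ℝ] p.V) p.Nbar p.Nbar := by
  have h : ∀ g ∈ p.Nbar, conjAff (c : p.V ≃ᵃ[ℝ] p.V) g = g := fun g hg => by
    rw [conjAff_self, ← Subgroup.mem_centralizer_iff.1 c.2 g hg, mul_inv_cancel_right]
  refine le_antisymm ?_ ?_
  · rintro _ ⟨g, hg, rfl⟩
    exact (h g hg).symm ▸ hg
  · intro g hg
    exact ⟨g, hg, h g hg⟩

/-- `κ : 𝒞 → 𝒦`, `κ(v + I) = (v + I)_⋆`. -/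
noncomputable def kappa : p.C →* p.K where
  toFun c := ⟨star (c : p.V ≃ᵃ[ℝ] p.V) (p.carries_C c), by
    obtain ⟨v, hv, hc⟩ := (p.mem_C_iff c).1 c.2
    refine ⟨v, hv, fun x => ?_⟩
    change p.cls ((c : p.V ≃ᵃ[ℝ] p.V) x) = _
    rw [hc]⟩
  map_one' := by
    refine Subtype.ext (Equiv.ext fun x => ?_)
    obtain ⟨x, rfl⟩ := p.cls_surjective x
    rfl
  map_mul' c d := by
    refine Subtype.ext (Equiv.ext fun x => ?_)
    obtain ⟨x, rfl⟩ := p.cls_surjective x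
    rfl

theorem kappa_apply (c : p.C) (x : p.V) :
    (p.kappa c : Equiv.Perm p.OrbV) (p.cls x) = p.cls ((c : p.V ≃ᵃ[ℝ] p.V) x) := rfl

theorem kappa_smul (g : p.Γ ⧸ p.N) (c : p.C) : p.kappa (g • c) = g • p.kappa c := by
  obtain ⟨γ, rfl⟩ := QuotientGroup.mk_surjective g
  obtain ⟨v, -, hc⟩ := (p.mem_C_iff c).1 c.2
  refine Subtype.ext (Equiv.ext fun x => ?_)
  obtain ⟨x, rfl⟩ := p.cls_surjective x
  rw [kappa_apply, p.smul_C_apply γ c hc, p.smul_K_apply γ (p.kappa c) (v := v)]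
  intro x
  rw [kappa_apply, hc]

/-- `𝒞` as a `Γ/N`-module. -/
noncomputable abbrev repC : Rep ℤ (p.Γ ⧸ p.N) := Rep.ofMulDistribMulAction (p.Γ ⧸ p.N) p.C

/-- `𝒦` as a `Γ/N`-module. -/
noncomputable abbrev repK : Rep ℤ (p.Γ ⧸ p.N) := Rep.ofMulDistribMulAction (p.Γ ⧸ p.N) p.K

/-- `κ` as a homomorphism of `Γ/N`-modules. -/
noncomputable def kappaHom : p.repC ⟶ p.repK :=
  Rep.ofHom
    { toLinearMap := p.kappa.toAdditive.toIntLinearMap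
      isIntertwining' := fun g => by
        refine LinearMap.ext fun c => ?_
        exact congrArg Additive.ofMul (p.kappa_smul g c.toMul) }

/-- `κ_* : H¹(Γ/N, 𝒞) → H¹(Γ/N, 𝒦)`. -/
noncomputable def kappaStar :
    groupCohomology.H1 p.repC →ₗ[ℤ] groupCohomology.H1 p.repK :=
  (groupCohomology.map (MonoidHom.id (p.Γ ⧸ p.N)) p.kappaHom 1).hom

end Pair

/-! ### Outer automorphism groups and the function `ω` -/

section Out

variable {G H J : Type*} [Group G] [Group H] [Group J]

instance innNormal : (MulAut.conj : G →* MulAut G).range.Normal where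
  conj_mem := by
    rintro _ ⟨g, rfl⟩ a
    refine ⟨a g, ?_⟩
    ext x
    simp

variable (G) in
/-- `Out(G) = Aut(G)/Inn(G)`. -/
abbrev Out : Type _ := MulAut G ⧸ (MulAut.conj : G →* MulAut G).range

/-- `α_# : Out(G) → Out(H)`, `α_#(ζ Inn(G)) = α ζ α⁻¹ Inn(H)`, for an isomorphism `α : G → H`. -/
def sharp (α : G ≃* H) : Out G ≃* Out H :=
  QuotientGroup.congr _ _ (MulAut.congr α) (by
    ext ζ
    constructor
    · rintro ⟨_, ⟨g, rfl⟩, rfl⟩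
      refine ⟨α g, ?_⟩
      ext x
      simp [MulAut.congr]
    · rintro ⟨h, rfl⟩
      refine ⟨MulAut.conj (α.symm h), ⟨_, rfl⟩, ?_⟩
      ext x
      simp [MulAut.congr])

theorem sharp_mk (α : G ≃* H) (ζ : MulAut G) :
    sharp α (QuotientGroup.mk ζ) = QuotientGroup.mk (MulAut.congr α ζ) := rfl

theorem sharp_trans (α : G ≃* H) (β : H ≃* J) (x : Out G) :
    sharp (α.trans β) x = sharp β (sharp α x) := by
  obtain ⟨ζ, rfl⟩ := QuotientGroup.mk_surjective x
  rfl

theorem sharp_symm_sharp (α : G ≃* H) (x : Out G) : sharp α.symm (sharp α x) = x := by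
  rw [← sharp_trans]
  obtain ⟨ζ, rfl⟩ := QuotientGroup.mk_surjective x
  rw [sharp_mk]
  congr 1
  ext x
  simp [MulAut.congr]

theorem sharp_sharp_symm (α : G ≃* H) (x : Out H) : sharp α (sharp α.symm x) = x :=
  sharp_symm_sharp α.symm x

theorem sharp_self (α : MulAut G) (x : Out G) :
    sharp α x = QuotientGroup.mk α * x * (QuotientGroup.mk α)⁻¹ := by
  obtain ⟨ζ, rfl⟩ := QuotientGroup.mk_surjective x
  rfl

variable (G H) in
/-- `Hom_f(G, Out(H))`: the homomorphisms from `G` to `Out(H)` with finite image. -/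
def HomFin : Type _ := {η : G →* Out H // Finite η.range}

variable (G H) in
/-- Two elements of `Hom_f(G, Out(H))` are equivalent if they are in the same orbit of the left
action of `Out(H)`, by conjugation, and the right action of `Aut(G)`, by composition (the latter
action induces an action of `Out(G)` on the set of `Out(H)`-orbits). -/
def homFinSetoid : Setoid (HomFin G H) where
  r η η' := ∃ (g : Out H) (b : MulAut G), ∀ x, η'.1 x = g * η.1 (b x) * g⁻¹
  iseqv :=
    { refl := fun η => ⟨1, 1, fun x => by simp⟩
      symm := by
        rintro η η' ⟨g, b, h⟩
        refine ⟨g⁻¹, b⁻¹, fun x => ?_⟩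
        rw [h, MulAut.apply_inv_self]; group
      trans := by
        rintro η η' η'' ⟨g, b, h⟩ ⟨g', b', h'⟩
        refine ⟨g' * g, b * b', fun x => ?_⟩
        rw [h', h, MulAut.mul_apply]; group }

variable (G H) in
/-- `Out(G, H) = (Out(H) \ Hom_f(G, Out(H))) / Out(G)`. -/
def OutSet : Type _ := Quotient (homFinSetoid G H)

end Out

namespace Pair

variable {n : ℕ} (p : Pair n)

/-- `𝒪 : Γ/N → Out(N)`, `𝒪(N γ) = γ_* Inn(N)`, where `γ_*(ν) = γ ν γ⁻¹`. -/
noncomputable def O : p.Γ ⧸ p.N →* Out p.N :=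
  QuotientGroup.map p.N (MulAut.conj : p.N →* MulAut p.N).range MulAut.conjNormal (by
    intro ν hν
    refine ⟨⟨ν, hν⟩, ?_⟩
    ext x
    simp)

theorem O_mk (γ : p.Γ) : p.O γ = QuotientGroup.mk (MulAut.conjNormal γ) := rfl

theorem one_rot (v : p.V) : (1 : p.V ≃ₗ[ℝ] p.V) v = v := rfl

/-- If `B̄ = I` and `b̄ = a + f` with `a + I` in `N` and `f` fixed by the point group of `N`, then
conjugation by `b + B` is an inner automorphism of `N`. -/
theorem O_eq_one {γ : p.Γ} (hγ : p.rot γ = 1) {a f : p.V} (ha : a ∈ p.L)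
    (hf : ∀ ν ∈ p.N, p.rot ν f = f) (h : p.vec γ = a + f) : p.O γ = 1 := by
  obtain ⟨τ, hτ, ht⟩ := ha
  rw [O_mk, QuotientGroup.eq_one_iff]
  refine ⟨⟨τ, hτ⟩, ?_⟩
  ext ⟨ν, hν⟩ : 1
  apply Subtype.ext
  change τ * ν * τ⁻¹ = γ * ν * γ⁻¹
  have hτr : p.rot τ = 1 := p.rot_eq_one_of_transl ht
  have hvi : ∀ δ : p.Γ, p.rot δ = 1 → p.vec δ⁻¹ = - p.vec δ := fun δ hδ => by
    have h1 := p.vec_mul δ δ⁻¹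
    rw [hδ, mul_inv_cancel] at h1
    have h2 : p.vec 1 = 0 := by simp [vec]
    rw [h2] at h1
    exact (neg_eq_of_add_eq_zero_right h1.symm).symm
  refine p.ext_of_mem (p.normal.conj_mem ν hν τ) (p.normal.conj_mem ν hν γ) ?_ ?_
  · rw [vec_mul, vec_mul, vec_mul, vec_mul, map_mul, map_mul, hvi τ hτr, hvi γ hγ, hτr, hγ,
      p.vec_of_transl ht, h, one_mul, one_rot, map_neg, map_neg, map_add, hf ν hν]
    abel
  · simp only [map_mul, map_inv, hτr, hγ]

theorem vec_commutator {γ ν k : p.Γ} (h : γ * ν = k * (ν * γ)) (hk : p.rot k = 1)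
    (hγ : p.rot γ = 1) : p.vec k = p.vec γ - p.rot ν (p.vec γ) := by
  have e2 := congrArg p.vec h
  rw [vec_mul, vec_mul, vec_mul, hk, hγ, one_rot, one_rot] at e2
  rw [eq_sub_iff_add_eq]
  have e4 : p.vec ν + (p.vec k + p.rot ν (p.vec γ)) = p.vec ν + p.vec γ := by
    rw [add_comm (p.vec ν) (p.vec γ), e2]; abel
  exact add_left_cancel e4

instance finite_O : Finite p.O.range := by
  -- the kernel of `Γ → GL(V)` has finite index
  have hK : (p.rot.ker).FiniteIndex := by
    infer_instance
  let c : ℕ := Fintype.card p.P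
  have hc : (c : ℝ) ≠ 0 := p.card_P_ne_zero
  -- the homomorphism from this kernel to `L / cL`
  have hw : ∀ γ : p.rot.ker, (c : ℤ) • p.vec γ - p.tr (p.vec γ) ∈ p.L := by
    rintro ⟨γ, hγ⟩
    have hγ' : p.rot γ = 1 := hγ
    have h1 : (c : ℤ) • p.vec γ - p.tr (p.vec γ)
        = ∑ A : p.P, (p.vec γ - (A : p.V ≃ₗ[ℝ] p.V) (p.vec γ)) := by
      rw [Finset.sum_sub_distrib, ← tr_apply]
      simp [c]
    rw [h1]
    refine Submodule.sum_mem _ ?_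
    rintro ⟨_, ν, hν, rfl⟩ _
    have h2 : p.vec (γ * ν * γ⁻¹ * ν⁻¹) ∈ p.L := by
      refine p.vec_mem_L (p.N.mul_mem (p.normal.conj_mem ν hν γ) (p.N.inv_mem hν)) ?_
      simp [hγ']
    have h3 : p.vec (γ * ν * γ⁻¹ * ν⁻¹) = p.vec γ - p.rot ν (p.vec γ) := by
      exact p.vec_commutator (by group) (by simp [hγ']) hγ'
    rwa [h3] at h2
  let cL : Submodule ℤ p.L := (⊤ : Submodule ℤ p.L).map ((c : ℤ) • LinearMap.id)
  have hfin : Finite (p.L ⧸ cL) := by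
    refine Module.finite_of_fg_torsion _ fun x => ?_
    refine ⟨⟨(c : ℤ), ?_⟩, ?_⟩
    · rw [mem_nonZeroDivisors_iff_ne_zero]
      exact_mod_cast Fintype.card_ne_zero
    · obtain ⟨y, rfl⟩ := Submodule.Quotient.mk_surjective _ x
      rw [Submonoid.mk_smul, ← Submodule.Quotient.mk_smul, Submodule.Quotient.mk_eq_zero]
      exact ⟨y, trivial, rfl⟩
  let F : p.rot.ker →* Multiplicative (p.L ⧸ cL) :=
    MonoidHom.mk' (fun γ => Multiplicative.ofAdd
      (Submodule.Quotient.mk (⟨(c : ℤ) • p.vec γ - p.tr (p.vec γ), hw γ⟩ : p.L))) (by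
      rintro ⟨γ, hγ⟩ ⟨δ, hδ⟩
      rw [← ofAdd_add, ← Submodule.Quotient.mk_add]
      congr 2
      apply Subtype.ext
      have hγ' : p.rot γ = 1 := hγ
      simp only [Subgroup.coe_mul, vec_mul, hγ', one_rot, smul_add, map_add,
        Submodule.coe_add]
      abel)
  have hF : F.ker.FiniteIndex := by infer_instance
  have hle : F.ker.map p.rot.ker.subtype ≤ (p.O.comp (QuotientGroup.mk' p.N)).ker := by
    rintro _ ⟨⟨γ, hγ⟩, hγF, rfl⟩
    have h1 : (Submodule.Quotient.mk (⟨(c : ℤ) • p.vec γ - p.tr (p.vec γ), hw ⟨γ, hγ⟩⟩ : p.L) :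
        p.L ⧸ cL) = 0 := hγF
    rw [Submodule.Quotient.mk_eq_zero] at h1
    obtain ⟨⟨a, ha⟩, -, h2⟩ := h1
    have h3 : (c : ℤ) • a = (c : ℤ) • p.vec γ - p.tr (p.vec γ) := congrArg Subtype.val h2
    refine p.O_eq_one (γ := γ) hγ (a := a) (f := p.vec γ - a) ha ?_ (by abel)
    intro ν hν
    have h4 : p.vec γ - a = (c : ℝ)⁻¹ • p.tr (p.vec γ) := by
      rw [eq_inv_smul_iff₀ hc, smul_sub]
      simp only [natCast_zsmul] at h3
      rw [Nat.cast_smul_eq_nsmul, Nat.cast_smul_eq_nsmul, h3]; abel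
    rw [h4, map_smul, p.rot_tr hν]
  have h5 : (F.ker.map p.rot.ker.subtype).FiniteIndex := by
    refine ⟨?_⟩
    rw [Subgroup.index_map_subtype]
    exact mul_ne_zero hF.index_ne_zero hK.index_ne_zero
  have h6 : (p.O.comp (QuotientGroup.mk' p.N)).ker.FiniteIndex :=
    Subgroup.finiteIndex_of_le hle
  have h7 : Finite (p.O.comp (QuotientGroup.mk' p.N)).range :=
    Finite.of_equiv _ (QuotientGroup.quotientKerEquivRange _).toEquiv
  have h8 : (p.O.comp (QuotientGroup.mk' p.N)).range = p.O.range := by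
    rw [MonoidHom.range_comp, MonoidHom.range_eq_top.2 (QuotientGroup.mk'_surjective p.N)]
    exact p.O.range_eq_map.symm
  rwa [h8] at h7

end Pair

/-! ### Isomorphism classes of pairs, and the function `ω` -/

/-- An isomorphism of pairs `(Γ₁, N₁) → (Γ₂, N₂)` exists: there is an isomorphism `ζ : Γ₁ → Γ₂`
with `ζ(N₁) = N₂`. -/
def PairIso {n : ℕ} (p q : Pair n) : Prop :=
  ∃ ζ : p.Γ ≃* q.Γ, p.N.map ζ.toMonoidHom = q.N

section Iso

variable {n k m : ℕ} (Δ : Subgroup (Isom k)) (M : Subgroup (Isom m))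

/-- The pairs `(Γ, N)` such that `N` is isomorphic to `M` and `Γ/N` is isomorphic to `Δ`. -/
def PairOver (n : ℕ) : Type :=
  {p : Pair n // Nonempty (p.N ≃* M) ∧ Nonempty (Δ ≃* p.Γ ⧸ p.N)}

/-- Isomorphism of pairs, as an equivalence relation. -/
def pairSetoid (n : ℕ) : Setoid (PairOver Δ M n) where
  r p q := PairIso p.1 q.1
  iseqv :=
    { refl := fun p => ⟨MulEquiv.refl _, by ext x; simp⟩
      symm := by
        rintro p q ⟨ζ, h⟩
        refine ⟨ζ.symm, ?_⟩
        rw [← h, Subgroup.map_map]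
        convert Subgroup.map_id _
        ext x
        simp
      trans := by
        rintro p q r ⟨ζ, h⟩ ⟨ξ, h'⟩
        refine ⟨ζ.trans ξ, ?_⟩
        rw [← h', ← h, Subgroup.map_map]
        rfl }

/-- `Iso(Δ, M)`: the set of isomorphism classes `[Γ, N]` of pairs. -/
def Iso (n : ℕ) : Type := Quotient (pairSetoid Δ M n)

variable {Δ M}

/-- The isomorphism class `[Γ, N]`. -/
def PairOver.cl (p : PairOver Δ M n) : Iso Δ M n := Quotient.mk (pairSetoid Δ M n) p

/-- The homomorphism `α_# 𝒪 β : Δ → Out(M)`. -/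
noncomputable def homOf (p : Pair n) (α : p.N ≃* M) (β : Δ ≃* p.Γ ⧸ p.N) : HomFin Δ M :=
  ⟨(sharp α).toMonoidHom.comp (p.O.comp β.toMonoidHom), by
    have h : (((sharp α).toMonoidHom.comp (p.O.comp β.toMonoidHom)).range : Set (Out M))
        ⊆ (sharp α) '' (p.O.range : Set (Out p.N)) := by
      rintro _ ⟨x, rfl⟩
      exact ⟨p.O (β x), ⟨_, rfl⟩, rfl⟩
    have hO : (p.O.range : Set (Out p.N)).Finite := p.finite_O
    exact (hO.image _).subset h⟩

theorem homOf_apply (p : Pair n) (α : p.N ≃* M) (β : Δ ≃* p.Γ ⧸ p.N) (x : Δ) :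
    (homOf p α β).1 x = sharp α (p.O (β x)) := rfl

/-- The class `[α_# 𝒪 β]` in `Out(Δ, M)` does not depend on `α` and `β`. -/
theorem homOf_equiv (p : Pair n) (α α' : p.N ≃* M) (β β' : Δ ≃* p.Γ ⧸ p.N) :
    (homFinSetoid Δ M) (homOf p α β) (homOf p α' β') := by
  refine ⟨QuotientGroup.mk (α.symm.trans α' : MulAut M), (β'.trans β.symm : MulAut Δ), fun x => ?_⟩
  rw [homOf_apply, homOf_apply, ← sharp_self, ← sharp_trans]
  have h1 : β ((β'.trans β.symm : MulAut Δ) x) = β' x := β.apply_symm_apply _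
  have h2 : α.trans (α.symm.trans α') = α' := by ext x; simp
  rw [h1, h2]

/-- An isomorphism of pairs `ζ` induces isomorphisms `α : N₁ → N₂` and `β : Γ₁/N₁ → Γ₂/N₂` with
`𝒪₂ β = α_# 𝒪₁`. -/
theorem exists_of_pairIso {p q : Pair n} (h : PairIso p q) :
    ∃ (α : p.N ≃* q.N) (β : p.Γ ⧸ p.N ≃* q.Γ ⧸ q.N), ∀ x, q.O (β x) = sharp α (p.O x) := by
  obtain ⟨ζ, h⟩ := h
  refine ⟨(ζ.subgroupMap p.N).trans (MulEquiv.subgroupCongr h),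
    QuotientGroup.congr p.N q.N ζ h, fun x => ?_⟩
  obtain ⟨γ, rfl⟩ := QuotientGroup.mk_surjective x
  rw [Pair.O_mk, sharp_mk]
  change q.O (QuotientGroup.mk (ζ γ)) = _
  rw [Pair.O_mk]
  congr 1
  ext1 x
  obtain ⟨x, rfl⟩ := ((ζ.subgroupMap p.N).trans (MulEquiv.subgroupCongr h)).surjective x
  apply Subtype.ext
  change ζ γ * ζ x * (ζ γ)⁻¹ = _
  simp only [MulAut.congr, MulEquiv.coe_mk, Equiv.coe_fn_mk, MulEquiv.trans_apply,
    MulEquiv.symm_trans_apply, MulEquiv.symm_apply_apply]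
  change _ = ζ (γ * x * γ⁻¹)
  simp

theorem homOf_congr {p q : Pair n} {α : p.N ≃* q.N} {β : p.Γ ⧸ p.N ≃* q.Γ ⧸ q.N}
    (h : ∀ x, q.O (β x) = sharp α (p.O x)) (α' : q.N ≃* M) (β' : Δ ≃* q.Γ ⧸ q.N) :
    homOf p (α.trans α') (β'.trans β.symm) = homOf q α' β' := by
  refine Subtype.ext (MonoidHom.ext fun x => ?_)
  have h1 : β (β.symm (β' x)) = β' x := β.apply_symm_apply _
  calc sharp (α.trans α') (p.O (β.symm (β' x)))
      = sharp α' (sharp α (p.O (β.symm (β' x)))) := sharp_trans _ _ _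
    _ = sharp α' (q.O (β (β.symm (β' x)))) := congrArg (sharp α') (h _).symm
    _ = sharp α' (q.O (β' x)) := by rw [h1]

/-- The element `[α_# 𝒪 β]` of `Out(Δ, M)` determined by the pair `(Γ, N)`. -/
noncomputable def PairOver.out (p : PairOver Δ M n) : OutSet Δ M :=
  Quotient.mk (homFinSetoid Δ M) (homOf p.1 p.2.1.some p.2.2.some)

theorem PairOver.out_eq (p : PairOver Δ M n) (α : p.1.N ≃* M) (β : Δ ≃* p.1.Γ ⧸ p.1.N) :
    p.out = Quotient.mk (homFinSetoid Δ M) (homOf p.1 α β) :=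
  Quotient.sound (homOf_equiv p.1 _ α _ β)

theorem PairOver.out_congr (p q : PairOver Δ M n) (h : PairIso p.1 q.1) : p.out = q.out := by
  obtain ⟨α, β, hαβ⟩ := exists_of_pairIso h
  exact (p.out_eq _ _).trans (congrArg (Quotient.mk (homFinSetoid Δ M))
    (homOf_congr hαβ q.2.1.some q.2.2.some))

/-- `ω : Iso(Δ, M) → Out(Δ, M)`, `ω([Γ, N]) = [α_# 𝒪 β]` for any choice of isomorphisms
`α : N → M` and `β : Δ → Γ/N`. -/
noncomputable def omegaMap : Iso Δ M n → OutSet Δ M :=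
  Quotient.lift PairOver.out PairOver.out_congr

end Iso

/-! ### The affinity `α̃` that induces an isomorphism `α : N₁ → N₂` -/

namespace Pair

variable {n : ℕ} (p q : Pair n)

theorem rot_eq_one_iff {ν : p.Γ} (hν : ν ∈ p.N) :
    p.rot ν = 1 ↔ ∀ μ ∈ p.N, ∃ j : ℕ, 0 < j ∧ ν * μ ^ j = μ ^ j * ν := by
  constructor
  · intro h μ hμ
    have hfo : IsOfFinOrder (p.rot.rangeRestrict μ) := isOfFinOrder_of_finite _
    obtain ⟨j, hj, hj'⟩ := isOfFinOrder_iff_pow_eq_one.1 hfo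
    have hμj : p.rot (μ ^ j) = 1 := by
      have := congrArg Subtype.val hj'
      simpa using this
    refine ⟨j, hj, p.ext_of_mem (p.N.mul_mem hν (p.N.pow_mem hμ j))
      (p.N.mul_mem (p.N.pow_mem hμ j) hν) ?_ ?_⟩
    · rw [vec_mul, vec_mul, h, hμj, one_rot, one_rot, add_comm]
    · rw [map_mul, map_mul, h, hμj]
  · intro h
    apply LinearEquiv.toLinearMap_injective
    refine p.linear_ext ?_
    rintro a ⟨τ, hτ, ht⟩
    obtain ⟨j, hj, hj'⟩ := h τ hτ
    have hτr : p.rot τ = 1 := p.rot_eq_one_of_transl ht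
    have hτj : p.rot (τ ^ j) = 1 := by rw [map_pow, hτr, one_pow]
    have hvj : ∀ i : ℕ, p.vec (τ ^ i) = (i : ℝ) • a := by
      intro i
      induction i with
      | zero => simp [vec]
      | succ i ih =>
        rw [pow_succ, vec_mul, ih, map_pow, hτr, one_pow, one_rot, p.vec_of_transl ht]
        push_cast
        rw [add_smul, one_smul]
    have h1 := congrArg p.vec hj'
    rw [vec_mul, vec_mul, hτj, one_rot, hvj, map_smul, add_comm] at h1
    have h2 := add_right_cancel h1
    have hj0 : (j : ℝ) ≠ 0 := by exact_mod_cast hj.ne'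
    exact smul_right_injective p.V hj0 h2

variable {p q}

theorem rot_map_eq_one (α : p.N ≃* q.N) {ν : p.N} (h : p.rot ν = 1) : q.rot (α ν) = 1 := by
  rw [rot_eq_one_iff _ (α ν).2]
  intro μ hμ
  obtain ⟨j, hj, hj'⟩ := (p.rot_eq_one_iff ν.2).1 h (α.symm ⟨μ, hμ⟩) (α.symm ⟨μ, hμ⟩).2
  refine ⟨j, hj, ?_⟩
  have h1 : ν * (α.symm ⟨μ, hμ⟩) ^ j = (α.symm ⟨μ, hμ⟩) ^ j * ν := Subtype.ext hj'
  have h2 := congrArg α h1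
  simp only [map_mul, map_pow, MulEquiv.apply_symm_apply] at h2
  exact congrArg Subtype.val h2

/-- The linear map of `V₁` into `V₂` that extends the restriction of `α` to the lattices. -/
theorem exists_linearMap (α : p.N ≃* q.N) :
    ∃ C : p.V →ₗ[ℝ] q.V, ∀ ν : p.N, p.rot ν = 1 → C (p.vec ν) = q.vec (α ν) := by
  have hex : ∀ a : p.L, ∃ τ : p.N, ((τ : p.Γ) : Isom n) = transl ((a : p.V) : E n) := by
    rintro ⟨a, τ, hτ, h⟩; exact ⟨⟨τ, hτ⟩, h⟩
  choose t ht using hex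
  have htr : ∀ a, p.rot (t a) = 1 := fun a => p.rot_eq_one_of_transl (ht a)
  have htv : ∀ a, p.vec (t a) = a := fun a => p.vec_of_transl (ht a)
  have huniq : ∀ (ν : p.N) (hν : p.rot ν = 1), t ⟨p.vec ν, p.vec_mem_L ν.2 hν⟩ = ν := by
    intro ν hν
    exact Subtype.ext (p.ext_of_mem (t _).2 ν.2 (htv _) (by rw [htr, hν]))
  have hadd : ∀ a b, t (a + b) = t a * t b := by
    intro a b
    refine Subtype.ext (p.ext_of_mem (t _).2 (p.N.mul_mem (t a).2 (t b).2) ?_ ?_)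
    · rw [htv, Subgroup.coe_mul, vec_mul, htv, htr, htv, one_rot]; rfl
    · rw [Subgroup.coe_mul, map_mul, htr, htr, htr, one_mul]
  let f : p.L →+ q.V := AddMonoidHom.mk' (fun a => q.vec (α (t a))) fun a b => by
    rw [hadd, map_mul, Subgroup.coe_mul, vec_mul, rot_map_eq_one α (htr a), one_rot]
  let b := Module.Free.chooseBasis ℤ p.L
  let c := b.ofZLatticeBasis ℝ p.L
  let C : p.V →ₗ[ℝ] q.V := c.constr ℝ fun i => f (b i)
  have hC : ∀ a : p.L, C (a : p.V) = f a := by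
    intro a
    have h1 : (C.restrictScalars ℤ).comp p.L.subtype = f.toIntLinearMap := by
      refine b.ext fun i => ?_
      change C ((b i : p.L) : p.V) = f (b i)
      rw [← b.ofZLatticeBasis_apply ℝ p.L i]
      exact c.constr_basis ℝ _ i
    exact congrArg (fun g : p.L →ₗ[ℤ] q.V => g a) h1
  refine ⟨C, fun ν hν => ?_⟩
  have := hC ⟨p.vec ν, p.vec_mem_L ν.2 hν⟩
  refine this.trans ?_
  change q.vec (α (t _)) = _
  rw [huniq ν hν]

theorem exists_linearEquiv (α : p.N ≃* q.N) :
    ∃ C : p.V ≃ₗ[ℝ] q.V, ∀ ν : p.N, p.rot ν = 1 → C (p.vec ν) = q.vec (α ν) := by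
  obtain ⟨C, hC⟩ := exists_linearMap α
  obtain ⟨D, hD⟩ := exists_linearMap α.symm
  have aux : ∀ {p q : Pair n} (α : p.N ≃* q.N) (C : p.V →ₗ[ℝ] q.V) (D : q.V →ₗ[ℝ] p.V),
      (∀ ν : p.N, p.rot ν = 1 → C (p.vec ν) = q.vec (α ν)) →
      (∀ ν : q.N, q.rot ν = 1 → D (q.vec ν) = p.vec (α.symm ν)) → D.comp C = LinearMap.id := by
    intro p q α C D hC hD
    refine p.linear_ext ?_
    rintro a ⟨τ, hτ, ht⟩
    have hτr : p.rot τ = 1 := p.rot_eq_one_of_transl ht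
    have h1 := hC ⟨τ, hτ⟩ hτr
    have h2 := hD (α ⟨τ, hτ⟩) (rot_map_eq_one α hτr)
    rw [α.symm_apply_apply, ← h1, p.vec_of_transl ht] at h2
    exact h2
  refine ⟨LinearEquiv.ofLinearMap C D (aux α.symm D C hD ?_) (aux α C D hC hD), hC⟩
  intro ν hν
  exact hC ν hν

/-- For an isomorphism `α : N₁ → N₂` there is an affinity `α̃ : V₁ → V₂` such that
`α̃ ν̄ α̃⁻¹` is the image of `α(ν)` in `N̄₂` for all `ν` in `N₁`. -/
theorem exists_affinity (α : p.N ≃* q.N) :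
    ∃ e : p.V ≃ᵃ[ℝ] q.V, ∀ ν : p.N, conjAff e (p.bar ν) = q.bar (α ν) := by
  obtain ⟨C, hC⟩ := exists_linearEquiv α
  -- the linear parts agree
  have hrot : ∀ (ν : p.N) (v : p.V), C (p.rot ν v) = q.rot (α ν) (C v) := by
    intro ν
    suffices h : (C : p.V →ₗ[ℝ] q.V).comp (p.rot ν : p.V →ₗ[ℝ] p.V)
        = (q.rot (α ν) : q.V →ₗ[ℝ] q.V).comp (C : p.V →ₗ[ℝ] q.V) from
      fun v => congrArg (fun f : p.V →ₗ[ℝ] q.V => f v) h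
    refine p.linear_ext ?_
    rintro a ⟨τ, hτ, ht⟩
    have hτr : p.rot τ = 1 := p.rot_eq_one_of_transl ht
    let τ' : p.N := ⟨τ, hτ⟩
    have hcr : p.rot (ν * τ' * ν⁻¹ : p.N) = 1 := by
      change p.rot (ν * τ * (ν : p.Γ)⁻¹) = 1
      simp [hτr]
    have key : ∀ (r : Pair n) (x y k : r.N), x * y = k * x → r.rot y = 1 → r.rot k = 1 →
        r.vec k = r.rot x (r.vec y) := by
      intro r x y k h hy hk
      have h1 := congrArg (fun z : r.N => r.vec z) h
      simp only [Subgroup.coe_mul] at h1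
      rw [vec_mul, vec_mul, hk, one_rot, add_comm] at h1
      exact (add_right_cancel h1).symm
    have h1 := hC _ hcr
    rw [key p ν τ' _ (by group) hτr hcr,
      key q (α ν) (α τ') (α (ν * τ' * ν⁻¹)) (by rw [← map_mul, ← map_mul]; congr 1; group)
        (rot_map_eq_one α hτr) (rot_map_eq_one α hcr), ← hC τ' hτr] at h1
    have h2 : p.vec τ' = a := p.vec_of_transl ht
    rw [h2] at h1
    exact h1
  -- the crossed homomorphism formed by the differences of the translation parts
  let s : p.N → q.V := fun ν => q.vec (α ν) - C (p.vec ν)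
  have hs : ∀ μ ν, s (μ * ν) = s μ + q.rot (α μ) (s ν) := by
    intro μ ν
    simp only [s, map_mul, Subgroup.coe_mul, vec_mul, map_add, map_sub, hrot]
    abel
  have hsT : ∀ ν : p.N, p.rot ν = 1 → s ν = 0 := fun ν hν => by
    simp only [s, hC ν hν, sub_self]
  have hsd : ∀ μ ν : p.N, p.rot μ = p.rot ν → s μ = s ν := by
    intro μ ν h
    have h1 : p.rot (μ⁻¹ * ν : p.N) = 1 := by
      change p.rot ((μ : p.Γ)⁻¹ * ν) = 1
      rw [map_mul, map_inv, h, inv_mul_cancel]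
    have h2 := hs μ (μ⁻¹ * ν)
    rw [hsT _ h1, map_zero, add_zero, mul_inv_cancel_left] at h2
    exact h2.symm
  have hlift : ∀ A : p.P, ∃ ν : p.N, p.rot ν = A := by
    rintro ⟨_, ν, hν, rfl⟩; exact ⟨⟨ν, hν⟩, rfl⟩
  choose l hl using hlift
  let S : q.V := ∑ A : p.P, s (l A)
  have hS : ∀ μ : p.N, S = (Fintype.card p.P : ℝ) • s μ + q.rot (α μ) S := by
    intro μ
    have h1 : S = ∑ A : p.P, s (μ * l A) := by
      symm
      refine Fintype.sum_equiv (Equiv.mulLeft (⟨p.rot μ, μ, μ.2, rfl⟩ : p.P)) _ _ fun A => ?_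
      apply hsd
      rw [hl, Subgroup.coe_mul, map_mul, hl]
      rfl
    calc S = ∑ A : p.P, s (μ * l A) := h1
      _ = (Fintype.card p.P : ℝ) • s μ + q.rot (α μ) S := by
        simp only [hs, Finset.sum_add_distrib, map_sum, S]
        simp [Nat.cast_smul_eq_nsmul]
  let c : q.V := (Fintype.card p.P : ℝ)⁻¹ • S
  have hc : ∀ μ : p.N, c = s μ + q.rot (α μ) c := by
    intro μ
    have h1 := congrArg (fun x => (Fintype.card p.P : ℝ)⁻¹ • x) (hS μ)
    simp only [smul_add, smul_smul, inv_mul_cancel₀ p.card_P_ne_zero, one_smul] at h1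
    rw [← map_smul] at h1
    exact h1
  refine ⟨C.toAffineEquiv.trans (AffineEquiv.constVAdd ℝ q.V c), fun ν => ?_⟩
  ext1 x
  obtain ⟨y, rfl⟩ := (C.toAffineEquiv.trans (AffineEquiv.constVAdd ℝ q.V c)).surjective x
  rw [conjAff_apply, AffineEquiv.symm_apply_apply]
  change c + C (p.bar ν y) = q.bar (α ν) (c + C y)
  rw [bar_apply, bar_apply, map_add, map_add, hrot]
  have h1 : s ν + C (p.vec ν) = q.vec (α ν) := sub_add_cancel _ _
  rw [← h1]
  nth_rewrite 1 [hc ν]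
  abel

/-- An affinity `α̃ : V₁ → V₂` that induces `α`: `α̃ ν̄ α̃⁻¹ = \overline{α(ν)}` for `ν` in `N₁`. -/
noncomputable def tilde (α : p.N ≃* q.N) : p.V ≃ᵃ[ℝ] q.V := (exists_affinity α).choose

theorem tilde_spec (α : p.N ≃* q.N) (ν : p.N) : conjAff (tilde α) (p.bar ν) = q.bar (α ν) :=
  (exists_affinity α).choose_spec ν

theorem carries_tilde (α : p.N ≃* q.N) : Carries (tilde α) p.Nbar q.Nbar := by
  refine le_antisymm ?_ ?_
  · rintro _ ⟨_, ⟨ν, hν, rfl⟩, rfl⟩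
    exact ⟨α ⟨ν, hν⟩, (α ⟨ν, hν⟩).2, (tilde_spec α ⟨ν, hν⟩).symm⟩
  · rintro _ ⟨ν, hν, rfl⟩
    refine ⟨p.bar (α.symm ⟨ν, hν⟩), ⟨_, (α.symm ⟨ν, hν⟩).2, rfl⟩, ?_⟩
    have := tilde_spec α (α.symm ⟨ν, hν⟩)
    rwa [α.apply_symm_apply] at this

/-! ### Fiber cohomology classes -/

/-- `α̃_⋆ : V₁/N₁ → V₂/N₂`. -/
noncomputable def tildeStar (α : p.N ≃* q.N) : p.OrbV ≃ q.OrbV := star (tilde α) (carries_tilde α)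

/-- `φ = α̃_♯⁻¹ Ξ₂ β`, that is, `φ(g) = α̃_⋆⁻¹ Ξ₂(β(g)) α̃_⋆`. -/
noncomputable def phi (α : p.N ≃* q.N) (β : p.Γ ⧸ p.N ≃* q.Γ ⧸ q.N) (g : p.Γ ⧸ p.N) :
    Equiv.Perm p.OrbV :=
  (tildeStar α).trans ((q.Xi (β g)).trans (tildeStar α).symm)

theorem phi_mul (α : p.N ≃* q.N) (β : p.Γ ⧸ p.N ≃* q.Γ ⧸ q.N) (g h : p.Γ ⧸ p.N) :
    phi α β (g * h) = phi α β g * phi α β h := by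
  refine Equiv.ext fun x => ?_
  simp [phi, Equiv.Perm.mul_apply]

/-- If `𝒪₁ = α_#⁻¹ 𝒪₂ β`, then `φ(g) Ξ₁(g)⁻¹` is in `𝒦₁` for all `g` in `Γ₁/N₁`. -/
theorem phi_mem (α : p.N ≃* q.N) (β : p.Γ ⧸ p.N ≃* q.Γ ⧸ q.N)
    (h : p.O = (sharp α).symm.toMonoidHom.comp (q.O.comp β.toMonoidHom)) (g : p.Γ ⧸ p.N) :
    phi α β g * (p.Xi g)⁻¹ ∈ p.K := by
  obtain ⟨γ, rfl⟩ := QuotientGroup.mk_surjective g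
  obtain ⟨δ, hδ⟩ := QuotientGroup.mk_surjective (β γ)
  have h1 : sharp α (p.O γ) = q.O δ := by
    rw [h, hδ]
    exact (sharp α).apply_symm_apply _
  rw [O_mk, O_mk, sharp_mk, eq_comm, QuotientGroup.eq] at h1
  obtain ⟨ν₀, hν₀⟩ := h1
  -- replace `δ` by `δ ν₀`
  have h2 : ∀ ν : p.N, q.bar (α (MulAut.conjNormal γ ν))
      = q.bar (δ * ν₀) * q.bar (α ν) * (q.bar (δ * ν₀))⁻¹ := by
    intro ν
    have h3 := congrArg (fun ζ : MulAut q.N => ζ (α ν)) hν₀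
    have h4 : (MulAut.conjNormal δ) (ν₀ * α ν * ν₀⁻¹) = α (MulAut.conjNormal γ ν) := by
      have h5 : ν₀ * α ν * ν₀⁻¹ = (MulAut.conjNormal δ)⁻¹ (α (MulAut.conjNormal γ ν)) := by
        have h6 : (MulAut.congr α (MulAut.conjNormal γ)) (α ν) = α (MulAut.conjNormal γ ν) := by
          simp [MulAut.congr]
        rw [← h6]
        exact h3
      rw [h5, MulAut.apply_inv_self]
    rw [← h4, MulAut.conjNormal_apply, ← map_inv, ← map_mul, ← map_mul]
    simp only [Subgroup.coe_mul, Subgroup.coe_inv, mul_assoc, mul_inv_rev]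
  have h3 : β γ = QuotientGroup.mk (δ * ν₀ : q.Γ) := by
    rw [← hδ]
    exact (QuotientGroup.mk_mul_of_mem δ ν₀.2).symm
  -- the affinity `α̃⁻¹ δ̄ α̃ γ̄⁻¹` centralizes `N̄₁`
  let c : p.V ≃ᵃ[ℝ] p.V := (conjAff (tilde α)).symm (q.bar (δ * ν₀)) * (p.bar γ)⁻¹
  have hc : c ∈ p.C := by
    rw [C, Subgroup.mem_centralizer_iff]
    rintro _ ⟨ν, hν, rfl⟩
    obtain ⟨μ, hμ⟩ : ∃ μ : p.N, MulAut.conjNormal γ μ = ⟨ν, hν⟩ :=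
      (MulAut.conjNormal γ : MulAut p.N).surjective _
    have h4 : p.bar ν = p.bar γ * p.bar μ * (p.bar γ)⁻¹ := by
      have h5 := congrArg (fun x : p.N => p.bar x) hμ
      simp only [MulAut.conjNormal_apply, map_mul, map_inv] at h5
      exact h5.symm
    have h5 : p.bar ν = (conjAff (tilde α)).symm (q.bar (δ * ν₀)) * p.bar μ
        * ((conjAff (tilde α)).symm (q.bar (δ * ν₀)))⁻¹ := by
      apply (conjAff (tilde α)).injective
      rw [map_mul, map_mul, map_inv, MulEquiv.apply_symm_apply, tilde_spec, ← h2, hμ]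
      exact tilde_spec α ⟨ν, hν⟩
    change p.bar ν * c = c * p.bar ν
    nth_rewrite 1 [h5]
    rw [h4]
    simp only [c]
    group
  obtain ⟨v, hv, hcv⟩ := (p.mem_C_iff c).1 hc
  refine ⟨v, hv, fun x => ?_⟩
  rw [← hcv, Equiv.Perm.mul_apply]
  have h4 : (p.Xi γ)⁻¹ (p.cls x) = p.cls ((p.bar γ)⁻¹ x) := by
    rw [Equiv.Perm.inv_eq_iff_eq, Xi_cls]
    congr 1
    exact ((p.bar γ).apply_symm_apply x).symm
  rw [h4]
  change (tildeStar α).symm (q.Xi (β γ) (tildeStar α (p.cls ((p.bar γ)⁻¹ x)))) = _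
  rw [Equiv.symm_apply_eq, h3]
  change q.cls (q.bar (δ * ν₀) (tilde α ((p.bar γ)⁻¹ x))) = q.cls (tilde α (c x))
  congr 1
  exact ((tilde α).apply_symm_apply _).symm

/-- The crossed homomorphism `φ ψ⁻¹ : Γ₁/N₁ → 𝒦₁`, where `φ = α̃_♯⁻¹ Ξ₂ β` and `ψ = Ξ₁`. -/
noncomputable def fiberCocycle (α : p.N ≃* q.N) (β : p.Γ ⧸ p.N ≃* q.Γ ⧸ q.N)
    (h : p.O = (sharp α).symm.toMonoidHom.comp (q.O.comp β.toMonoidHom)) (g : p.Γ ⧸ p.N) : p.K :=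
  ⟨phi α β g * (p.Xi g)⁻¹, phi_mem α β h g⟩

theorem fiberCocycle_isMulCocycle (α : p.N ≃* q.N) (β : p.Γ ⧸ p.N ≃* q.Γ ⧸ q.N)
    (h : p.O = (sharp α).symm.toMonoidHom.comp (q.O.comp β.toMonoidHom)) :
    groupCohomology.IsMulCocycle₁ (fiberCocycle α β h) := by
  intro g g'
  rw [mul_comm]
  apply Subtype.ext
  change phi α β (g * g') * (p.Xi (g * g'))⁻¹ = phi α β g * (p.Xi g)⁻¹
    * (p.Xi g * (phi α β g' * (p.Xi g')⁻¹) * (p.Xi g)⁻¹)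
  rw [phi_mul, map_mul]
  group

/-- The class `[Γ₁, N₁; Γ₂, N₂; α, β]` in `H¹(Γ₁/N₁, 𝒦₁)` (it does not depend on the choice
of the affinity `α̃`). -/
noncomputable def fiberClass (α : p.N ≃* q.N) (β : p.Γ ⧸ p.N ≃* q.Γ ⧸ q.N)
    (h : p.O = (sharp α).symm.toMonoidHom.comp (q.O.comp β.toMonoidHom)) :
    groupCohomology.H1 p.repK :=
  groupCohomology.H1π p.repK
    (groupCohomology.cocyclesOfIsMulCocycle₁ (fiberCocycle_isMulCocycle α β h))

end Pair

end SpaceGroups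

/-!
An element `γ` of `Γᵢ` is determined by the pair `(γ̄, Nᵢγ)`, because an element of `Nᵢ` that acts
trivially on `Vᵢ` is trivial. The pairs `(a, g)` that arise in this way are exactly those for which
the affinity `a` of `Vᵢ` induces `Ξᵢ(g)` on `Vᵢ/Nᵢ`: this rests on the fact that an affinity
that induces the identity of `V/N` lies in `N̄` (`Pair.mem_Nbar_of_cls_eq`), a consequence of Baire's
theorem and the countability of `N`. Transporting along `α̃ᵢ` and `βᵢ`, the
group `Γᵢ` becomes the fibre product
`Pᵢ = {(a, g) ∈ Aff(V) × Γ/N : a induces φᵢ(g) on V/N}`, where `φᵢ(g) = (α̃ᵢ)_⋆⁻¹ Ξᵢ(βᵢ(g)) (α̃ᵢ)_⋆`,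
and `Nᵢ` becomes the set of its elements with second component `1` (`Pair.range_toAffProd`,
`Pair.toAffProd_snd_eq_one_iff`).

If the classes of `φ₁ Ξ⁻¹` and `φ₂ Ξ⁻¹` differ by an element of the image of `κ_*`, then there are a
crossed homomorphism `c : Γ/N → 𝒞` and an element `d` of `𝒞` with
`φ₁(g) = κ(c(g)) κ(d) φ₂(g) κ(d)⁻¹` for all `g`
(`Pair.exists_cocycle_of_fiberClass`). Then `(a, g) ↦ (c(g) d a d⁻¹, g)` is an isomorphism
`P₂ → P₁` (`Pair.exists_fiberProd_equiv`). It is multiplicative because an affinity that induces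
`φᵢ(g)` acts on `𝒞` by conjugation in the same way as `g` does (`Pair.conj_eq_smul`). As it preserves
second components, it gives an isomorphism of `(Γ₂, N₂)` with `(Γ₁, N₁)`.
-/

namespace SpaceGroups

namespace Pair

variable {n : ℕ} (p q : Pair n)

/-! ### Affinities that induce the identity of the orbit space -/

theorem countable_Γ : Countable p.Γ := by
  have hd : DiscreteTopology p.Γ := p.isSpaceGroup.1
  have h1 : SecondCountableTopology (Isom n) :=
    TopologicalSpace.secondCountableTopology_induced _ _ _
  have h2 : LindelofSpace p.Γ := inferInstance
  exact countable_of_Lindelof_of_discrete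

theorem cls_eq_iff (x y : p.V) : p.cls x = p.cls y ↔ ∃ ν ∈ p.N, p.bar ν y = x := by
  constructor
  · intro h
    have h1 : MulAction.orbitRel p.Nbar p.V x y := Quotient.exact h
    rw [MulAction.orbitRel_apply] at h1
    obtain ⟨⟨_, ν, hν, rfl⟩, h2⟩ := h1
    exact ⟨ν, hν, h2⟩
  · rintro ⟨ν, hν, rfl⟩
    exact p.cls_eq_of_mem hν y

/-- An affinity of `V` that induces the identity of `V/N` is in `N̄`. -/
theorem mem_Nbar_of_cls_eq {a : p.V ≃ᵃ[ℝ] p.V} (h : ∀ x, p.cls (a x) = p.cls x) : a ∈ p.Nbar := by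
  have := p.countable_Γ
  -- `V` is covered by the countably many closed sets on which `a` agrees with an element of `N̄`.
  have hclosed : ∀ ν : p.N, IsClosed {x : p.V | p.bar ν x = a x} := fun ν =>
    isClosed_eq (p.bar ν).toAffineMap.continuous_of_finiteDimensional
      a.toAffineMap.continuous_of_finiteDimensional
  have hcover : (⋃ ν : p.N, {x : p.V | p.bar ν x = a x}) = Set.univ := by
    refine Set.eq_univ_of_forall fun x => ?_
    obtain ⟨ν, hν, hx⟩ := (p.cls_eq_iff _ _).1 (h x)
    exact Set.mem_iUnion.2 ⟨⟨ν, hν⟩, hx⟩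
  obtain ⟨ν, hν⟩ := nonempty_interior_of_iUnion_of_closed hclosed hcover
  exact ⟨ν, ν.2, AffineEquiv.ext_on (isOpen_interior.affineSpan_eq_top hν) _ _
    fun x hx => (interior_subset hx : x ∈ {x : p.V | p.bar ν x = a x})⟩

/-! ### The fibre product description of a pair -/

/-- The fibre product of `Aff(V)` and `Γ/N` over `φ : Γ/N → Perm(V/N)`: the pairs `(a, g)` such that
the affinity `a` induces the bijection `φ(g)` of `V/N`. -/
noncomputable def fiberProd (φ : p.Γ ⧸ p.N →* Equiv.Perm p.OrbV) :
    Subgroup ((p.V ≃ᵃ[ℝ] p.V) × (p.Γ ⧸ p.N)) where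
  carrier := {z | ∀ x, p.cls (z.1 x) = φ z.2 (p.cls x)}
  one_mem' x := by
    change p.cls x = φ 1 (p.cls x)
    rw [map_one]; rfl
  mul_mem' {z w} hz hw x := by
    change p.cls (z.1 (w.1 x)) = φ (z.2 * w.2) (p.cls x)
    rw [hz, hw, map_mul, Equiv.Perm.mul_apply]
  inv_mem' {z} hz x := by
    change p.cls (z.1⁻¹ x) = φ z.2⁻¹ (p.cls x)
    rw [map_inv, Equiv.Perm.eq_inv_iff_eq, ← hz]
    congr 1
    exact z.1.apply_symm_apply x

variable {p q}

/-- `φ = α̃_♯⁻¹ Ξ₂ β` as a homomorphism. -/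
noncomputable def phiHom (α : p.N ≃* q.N) (β : p.Γ ⧸ p.N ≃* q.Γ ⧸ q.N) :
    p.Γ ⧸ p.N →* Equiv.Perm p.OrbV :=
  MonoidHom.mk' (phi α β) (phi_mul α β)

/-- The homomorphism `δ ↦ (α̃⁻¹ δ̄ α̃, β⁻¹(N₂δ))` of `Γ₂` into `Aff(V₁) × Γ₁/N₁`. -/
noncomputable def toAffProd (α : p.N ≃* q.N) (β : p.Γ ⧸ p.N ≃* q.Γ ⧸ q.N) :
    q.Γ →* (p.V ≃ᵃ[ℝ] p.V) × (p.Γ ⧸ p.N) :=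
  ((conjAff (tilde α)).symm.toMonoidHom.comp q.bar).prod
    (β.symm.toMonoidHom.comp (QuotientGroup.mk' q.N))

theorem toAffProd_fst (α : p.N ≃* q.N) (β : p.Γ ⧸ p.N ≃* q.Γ ⧸ q.N) (δ : q.Γ) :
    (toAffProd α β δ).1 = (conjAff (tilde α)).symm (q.bar δ) := rfl

theorem toAffProd_snd (α : p.N ≃* q.N) (β : p.Γ ⧸ p.N ≃* q.Γ ⧸ q.N) (δ : q.Γ) :
    (toAffProd α β δ).2 = β.symm δ := rfl

theorem toAffProd_snd_eq_one_iff (α : p.N ≃* q.N) (β : p.Γ ⧸ p.N ≃* q.Γ ⧸ q.N) (δ : q.Γ) :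
    (toAffProd α β δ).2 = 1 ↔ δ ∈ q.N := by
  rw [toAffProd_snd, map_eq_one_iff β.symm β.symm.injective, QuotientGroup.eq_one_iff]

theorem toAffProd_injective (α : p.N ≃* q.N) (β : p.Γ ⧸ p.N ≃* q.Γ ⧸ q.N) :
    Function.Injective (toAffProd α β) := by
  rw [injective_iff_map_eq_one]
  intro δ hδ
  have h1 : δ ∈ q.N := (toAffProd_snd_eq_one_iff α β δ).1 (congrArg Prod.snd hδ)
  have h2 : (conjAff (tilde α)).symm (q.bar δ) = 1 := congrArg Prod.fst hδ
  rw [map_eq_one_iff _ (conjAff (tilde α)).symm.injective] at h2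
  exact q.bar_injOn h1 q.N.one_mem (h2.trans (map_one q.bar).symm)

theorem cls_toAffProd (α : p.N ≃* q.N) (β : p.Γ ⧸ p.N ≃* q.Γ ⧸ q.N) (δ : q.Γ) (x : p.V) :
    p.cls ((toAffProd α β δ).1 x) = phiHom α β (toAffProd α β δ).2 (p.cls x) := by
  change _ = (tildeStar α).symm (q.Xi (β (β.symm δ)) (tildeStar α (p.cls x)))
  rw [Equiv.eq_symm_apply, β.apply_symm_apply]
  change q.cls (tilde α ((tilde α).symm (q.bar δ (tilde α x)))) = q.cls (q.bar δ (tilde α x))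
  rw [AffineEquiv.apply_symm_apply]

/-- `Γ₂` is the fibre product of `Aff(V₁)` and `Γ₁/N₁` over `φ = α̃_♯⁻¹ Ξ₂ β`. -/
theorem range_toAffProd (α : p.N ≃* q.N) (β : p.Γ ⧸ p.N ≃* q.Γ ⧸ q.N) :
    (toAffProd α β).range = p.fiberProd (phiHom α β) := by
  refine le_antisymm ?_ ?_
  · rintro _ ⟨δ, rfl⟩
    exact cls_toAffProd α β δ
  · rintro ⟨a, g⟩ hz
    obtain ⟨δ, hδ⟩ := QuotientGroup.mk_surjective (β g)
    have hg : β.symm δ = g := by rw [hδ, β.symm_apply_apply]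
    -- `a` and `α̃⁻¹ δ̄ α̃` induce the same bijection of `V₁/N₁`, so they differ by an element of `N̄₁`.
    obtain ⟨ν, hν, h⟩ : a * ((toAffProd α β δ).1)⁻¹ ∈ p.Nbar := by
      refine p.mem_Nbar_of_cls_eq fun x => ?_
      have h1 := hz (((toAffProd α β δ).1)⁻¹ x)
      have h2 := cls_toAffProd α β δ (((toAffProd α β δ).1)⁻¹ x)
      rw [toAffProd_snd, hg] at h2
      refine h1.trans (h2.symm.trans (congrArg p.cls ?_))
      exact AffineEquiv.apply_symm_apply _ x
    have h3 : (conjAff (tilde α)).symm (q.bar (α ⟨ν, hν⟩)) = p.bar ν := by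
      rw [MulEquiv.symm_apply_eq]
      exact (tilde_spec α ⟨ν, hν⟩).symm
    refine ⟨α ⟨ν, hν⟩ * δ, Prod.ext ?_ ?_⟩
    · rw [toAffProd_fst, map_mul, map_mul, h3, h, toAffProd_fst, inv_mul_cancel_right]
    · rw [map_mul, Prod.snd_mul, (toAffProd_snd_eq_one_iff α β _).2 (α ⟨ν, hν⟩).2, one_mul,
        toAffProd_snd, hg]

/-- The isomorphism of `Γ₂` with the fibre product of `Aff(V₁)` and `Γ₁/N₁` over
`φ = α̃_♯⁻¹ Ξ₂ β`. -/
noncomputable def equivFiberProd (α : p.N ≃* q.N) (β : p.Γ ⧸ p.N ≃* q.Γ ⧸ q.N) :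
    q.Γ ≃* p.fiberProd (phiHom α β) :=
  (MonoidHom.ofInjective (toAffProd_injective α β)).trans
    (MulEquiv.subgroupCongr (range_toAffProd α β))

theorem equivFiberProd_snd_eq_one_iff (α : p.N ≃* q.N) (β : p.Γ ⧸ p.N ≃* q.Γ ⧸ q.N) (δ : q.Γ) :
    (equivFiberProd α β δ).1.2 = 1 ↔ δ ∈ q.N :=
  toAffProd_snd_eq_one_iff α β δ

/-! ### Isomorphisms of fibre products -/

theorem kappa_surjective : Function.Surjective p.kappa := by
  rintro ⟨k, v, hv, hk⟩
  refine ⟨⟨AffineEquiv.constVAdd ℝ p.V v, (p.mem_C_iff _).2 ⟨v, hv, fun _ => rfl⟩⟩, ?_⟩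
  refine Subtype.ext (Equiv.ext fun x => ?_)
  obtain ⟨x, rfl⟩ := p.cls_surjective x
  exact (hk x).symm

theorem coe_smul_C (γ : p.Γ) (c : p.C) :
    (((γ : p.Γ ⧸ p.N) • c : p.C) : p.V ≃ᵃ[ℝ] p.V) = p.bar γ * c * (p.bar γ)⁻¹ := by
  rw [← map_inv]; rfl

/-- If `φ` differs from `Ξ` by elements of `𝒦`, then an affinity that induces `φ(g)` acts on `𝒞` by
conjugation in the same way as `g` does. -/
theorem conj_eq_smul {φ : p.Γ ⧸ p.N →* Equiv.Perm p.OrbV} (hφ : ∀ g, φ g * (p.Xi g)⁻¹ ∈ p.K)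
    {z : (p.V ≃ᵃ[ℝ] p.V) × (p.Γ ⧸ p.N)} (hz : z ∈ p.fiberProd φ) (c : p.C) :
    z.1 * c * z.1⁻¹ = ((z.2 • c : p.C) : p.V ≃ᵃ[ℝ] p.V) := by
  obtain ⟨a, g⟩ := z
  obtain ⟨γ, rfl⟩ := QuotientGroup.mk_surjective g
  obtain ⟨e, he⟩ := kappa_surjective (p := p) ⟨_, hφ γ⟩
  have he' : (p.kappa e : Equiv.Perm p.OrbV) * p.Xi γ = φ γ := by
    rw [he, inv_mul_cancel_right]
  -- `a` and `e γ̄` induce the same bijection of `V/N`, so they differ by an element of `N̄`.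
  have hb : a * (e * p.bar γ)⁻¹ ∈ p.Nbar := by
    refine p.mem_Nbar_of_cls_eq fun y => ?_
    obtain ⟨x, rfl⟩ : ∃ x, (e * p.bar γ : p.V ≃ᵃ[ℝ] p.V) x = y := AffineEquiv.surjective _ y
    have h1 : (a * (e * p.bar γ)⁻¹) ((e * p.bar γ : p.V ≃ᵃ[ℝ] p.V) x) = a x :=
      congrArg a (AffineEquiv.symm_apply_apply (e * p.bar γ : p.V ≃ᵃ[ℝ] p.V) x)
    rw [h1]
    refine (hz x).trans ?_
    rw [← he', Equiv.Perm.mul_apply, Xi_cls, kappa_apply]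
    rfl
  generalize hb' : a * (e * p.bar γ)⁻¹ = b at hb
  have ha : a = b * e * p.bar γ := by rw [← hb']; group
  change a * c * a⁻¹ = _
  have hcomm : (e : p.V ≃ᵃ[ℝ] p.V) * ((γ : p.Γ ⧸ p.N) • c : p.C)
      = ((γ : p.Γ ⧸ p.N) • c : p.C) * e := congrArg Subtype.val (mul_comm e _)
  have hcent := Subgroup.mem_centralizer_iff.1 ((γ : p.Γ ⧸ p.N) • c : p.C).2 b hb
  calc a * c * a⁻¹ = b * (e * (p.bar γ * c * (p.bar γ)⁻¹)) * (e : p.V ≃ᵃ[ℝ] p.V)⁻¹ * b⁻¹ := by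
        rw [ha]; group
    _ = _ := by
        rw [← coe_smul_C, hcomm, ← mul_assoc, mul_inv_cancel_right, hcent, mul_inv_cancel_right]

/-- Twisting by a crossed homomorphism `c : Γ/N → 𝒞` and conjugating by an element `d` of `𝒞` gives
an isomorphism of fibre products that is the identity on second components. -/
theorem exists_fiberProd_equiv {φ ψ : p.Γ ⧸ p.N →* Equiv.Perm p.OrbV}
    (hφ : ∀ g, φ g * (p.Xi g)⁻¹ ∈ p.K) {c : p.Γ ⧸ p.N → p.C}
    (hc : groupCohomology.IsMulCocycle₁ c) (d : p.C)
    (h : ∀ g, ψ g = p.kappa (c g) * p.kappa d * φ g * (p.kappa d : Equiv.Perm p.OrbV)⁻¹) :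
    ∃ F : p.fiberProd φ ≃* p.fiberProd ψ, ∀ z, (F z).1.2 = z.1.2 := by
  have hinv : ∀ x : p.V, (p.kappa d : Equiv.Perm p.OrbV)⁻¹ (p.cls x)
      = p.cls ((d : p.V ≃ᵃ[ℝ] p.V)⁻¹ x) := fun x => by
    rw [Equiv.Perm.inv_eq_iff_eq, kappa_apply]
    exact congrArg p.cls (AffineEquiv.apply_symm_apply _ x).symm
  have hmem : ∀ z : p.fiberProd φ, ((c z.1.2 * d * z.1.1 * (d : p.V ≃ᵃ[ℝ] p.V)⁻¹, z.1.2) :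
      (p.V ≃ᵃ[ℝ] p.V) × (p.Γ ⧸ p.N)) ∈ p.fiberProd ψ := by
    intro z x
    change _ = ψ z.1.2 (p.cls x)
    rw [h, Equiv.Perm.mul_apply, Equiv.Perm.mul_apply, Equiv.Perm.mul_apply, hinv, ← z.2,
      kappa_apply, kappa_apply]
    rfl
  let F : p.fiberProd φ →* p.fiberProd ψ := MonoidHom.mk' (fun z => ⟨_, hmem z⟩) (by
    intro z w
    refine Subtype.ext (Prod.ext ?_ rfl)
    change (c (z.1.2 * w.1.2) * d * (z.1.1 * w.1.1) * (d : p.V ≃ᵃ[ℝ] p.V)⁻¹ : p.V ≃ᵃ[ℝ] p.V)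
      = c z.1.2 * d * z.1.1 * (d : p.V ≃ᵃ[ℝ] p.V)⁻¹ * (c w.1.2 * d * w.1.1 * (d : p.V ≃ᵃ[ℝ] p.V)⁻¹)
    have h1 : (c (z.1.2 * w.1.2) * d : p.V ≃ᵃ[ℝ] p.V)
        = c z.1.2 * d * (z.1.2 • c w.1.2 : p.C) := by
      have h2 : c (z.1.2 * w.1.2) * d = c z.1.2 * d * (z.1.2 • c w.1.2) := by
        rw [hc, mul_comm (z.1.2 • c w.1.2), mul_right_comm]
      exact congrArg Subtype.val h2
    have h3 : (c w.1.2 * d : p.V ≃ᵃ[ℝ] p.V) = d * c w.1.2 :=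
      congrArg Subtype.val (mul_comm (c w.1.2) d)
    rw [h1, ← conj_eq_smul hφ z.2, h3]
    group)
  refine ⟨MulEquiv.ofBijective F ⟨?_, ?_⟩, fun _ => rfl⟩
  · intro z w hzw
    have h2 : z.1.2 = w.1.2 := congrArg (fun z => z.1.2) hzw
    have h1 : (c z.1.2 * d * z.1.1 * (d : p.V ≃ᵃ[ℝ] p.V)⁻¹ : p.V ≃ᵃ[ℝ] p.V)
      = c w.1.2 * d * w.1.1 * (d : p.V ≃ᵃ[ℝ] p.V)⁻¹ := congrArg (fun z => z.1.1) hzw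
    rw [h2] at h1
    exact Subtype.ext (Prod.ext (mul_left_cancel (mul_right_cancel h1)) h2)
  · rintro ⟨⟨a, g⟩, hz⟩
    have hpre : (((c g * d : p.V ≃ᵃ[ℝ] p.V)⁻¹ * a * d, g) :
        (p.V ≃ᵃ[ℝ] p.V) × (p.Γ ⧸ p.N)) ∈ p.fiberProd φ := by
      intro x
      apply (p.kappa (c g) * p.kappa d : Equiv.Perm p.OrbV).injective
      have h1 : (p.kappa (c g) * p.kappa d : Equiv.Perm p.OrbV) * φ g = ψ g * p.kappa d := by
        rw [h, inv_mul_cancel_right]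
      have h2 := congrArg (fun σ : Equiv.Perm p.OrbV => σ (p.cls x)) h1
      simp only [Equiv.Perm.mul_apply] at h2 ⊢
      rw [h2, kappa_apply, kappa_apply, kappa_apply]
      refine Eq.trans (congrArg p.cls ?_) (hz _)
      exact AffineEquiv.apply_symm_apply (c g * d : p.V ≃ᵃ[ℝ] p.V) _
    refine ⟨⟨_, hpre⟩, Subtype.ext (Prod.ext ?_ rfl)⟩
    change (c g * d * ((c g * d : p.V ≃ᵃ[ℝ] p.V)⁻¹ * a * d) * (d : p.V ≃ᵃ[ℝ] p.V)⁻¹ :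
      p.V ≃ᵃ[ℝ] p.V) = a
    group

/-- Pairs whose fibre products are isomorphic, by an isomorphism that is the identity on second
components, are isomorphic. -/
theorem pairIso_of_fiberProd_equiv {q₁ q₂ : Pair n}
    {α₁ : p.N ≃* q₁.N} {β₁ : p.Γ ⧸ p.N ≃* q₁.Γ ⧸ q₁.N}
    {α₂ : p.N ≃* q₂.N} {β₂ : p.Γ ⧸ p.N ≃* q₂.Γ ⧸ q₂.N}
    (F : p.fiberProd (phiHom α₁ β₁) ≃* p.fiberProd (phiHom α₂ β₂))
    (hF : ∀ z, (F z).1.2 = z.1.2) : PairIso q₁ q₂ := by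
  let ζ : q₁.Γ ≃* q₂.Γ := ((equivFiberProd α₁ β₁).trans F).trans (equivFiberProd α₂ β₂).symm
  have hζ : ∀ δ, equivFiberProd α₂ β₂ (ζ δ) = F (equivFiberProd α₁ β₁ δ) := fun δ =>
    (equivFiberProd α₂ β₂).apply_symm_apply _
  have key : ∀ δ, ζ δ ∈ q₂.N ↔ δ ∈ q₁.N := fun δ => by
    rw [← equivFiberProd_snd_eq_one_iff α₂ β₂, ← equivFiberProd_snd_eq_one_iff α₁ β₁, hζ, hF]
  refine ⟨ζ, ?_⟩
  ext x
  obtain ⟨δ, rfl⟩ := ζ.surjective x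
  rw [key]
  exact Subgroup.mem_map_iff_mem ζ.injective

/-! ### Fibre cohomology classes in the same coset -/

theorem kappaStar_H1π (z : groupCohomology.cocycles₁ p.repC) :
    p.kappaStar (groupCohomology.H1π p.repC z)
      = groupCohomology.H1π p.repK
        (groupCohomology.mapCocycles₁ (MonoidHom.id (p.Γ ⧸ p.N)) p.kappaHom z) :=
  groupCohomology.H1π_comp_map_apply (A := p.repC) (B := p.repK) (MonoidHom.id (p.Γ ⧸ p.N))
    p.kappaHom z

/-- Two fibre cohomology classes in the same coset of the image of `κ_*` come from homomorphisms
`φ₁`, `φ₂` that differ by a crossed homomorphism into `𝒞` and conjugation by an element of `𝒞`. -/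
theorem exists_cocycle_of_fiberClass {q₁ q₂ : Pair n}
    {α₁ : p.N ≃* q₁.N} {β₁ : p.Γ ⧸ p.N ≃* q₁.Γ ⧸ q₁.N}
    {h₁ : p.O = (sharp α₁).symm.toMonoidHom.comp (q₁.O.comp β₁.toMonoidHom)}
    {α₂ : p.N ≃* q₂.N} {β₂ : p.Γ ⧸ p.N ≃* q₂.Γ ⧸ q₂.N}
    {h₂ : p.O = (sharp α₂).symm.toMonoidHom.comp (q₂.O.comp β₂.toMonoidHom)}
    (h : (Submodule.Quotient.mk (fiberClass α₁ β₁ h₁) :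
        groupCohomology.H1 p.repK ⧸ LinearMap.range p.kappaStar)
      = Submodule.Quotient.mk (fiberClass α₂ β₂ h₂)) :
    ∃ c : p.Γ ⧸ p.N → p.C, groupCohomology.IsMulCocycle₁ c ∧ ∃ d : p.C, ∀ g,
      phiHom α₁ β₁ g
        = p.kappa (c g) * p.kappa d * phiHom α₂ β₂ g * (p.kappa d : Equiv.Perm p.OrbV)⁻¹ := by
  rw [Submodule.Quotient.eq] at h
  obtain ⟨y, hy⟩ := h
  induction y using groupCohomology.H1_induction_on with
  | _ z =>
  rw [kappaStar_H1π, fiberClass, fiberClass, ← map_sub, groupCohomology.H1π_eq_iff] at hy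
  obtain ⟨k, hk⟩ := groupCohomology.isMulCoboundary₁_of_mem_coboundaries₁ _ hy
  let c : p.Γ ⧸ p.N → p.C := fun g => Additive.toMul (z g)
  have hk' : ∀ g, g • k / k
      = p.kappa (c g) / (fiberCocycle α₁ β₁ h₁ g / fiberCocycle α₂ β₂ h₂ g) := hk
  obtain ⟨d, rfl⟩ := kappa_surjective (p := p) k
  refine ⟨c, groupCohomology.isMulCocycle₁_of_mem_cocycles₁ _ z.2, d, fun g => ?_⟩
  have h1 : fiberCocycle α₁ β₁ h₁ g
      = p.kappa (c g) * p.kappa d * fiberCocycle α₂ β₂ h₂ g * (g • p.kappa d)⁻¹ := by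
    have h2 := hk' g
    rw [div_div_eq_mul_div, div_eq_div_iff_mul_eq_mul] at h2
    rw [eq_mul_inv_iff_mul_eq, mul_comm, h2]
    rw [mul_right_comm]
  have h2 : phi α₁ β₁ g * (p.Xi g)⁻¹ = p.kappa (c g) * p.kappa d * (phi α₂ β₂ g * (p.Xi g)⁻¹)
      * (p.Xi g * p.kappa d * (p.Xi g)⁻¹)⁻¹ := congrArg Subtype.val h1
  change phi α₁ β₁ g = p.kappa (c g) * p.kappa d * phi α₂ β₂ g * _
  rw [mul_inv_eq_iff_eq_mul] at h2
  rw [h2]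
  group

end Pair

end SpaceGroups

theorem lemma7 (n m : ℕ) (hm : 0 < m) (hmn : m < n)
    (M : Subgroup (SpaceGroups.Isom m)) (hM : SpaceGroups.IsSpaceGroup M)
    (Δ : Subgroup (SpaceGroups.Isom (n - m))) (hΔ : SpaceGroups.IsSpaceGroup Δ)
    -- the pairs `(Γ, N)`, `(Γ₁, N₁)`, `(Γ₂, N₂)`
    (p p₁ p₂ : SpaceGroups.PairOver Δ M n)
    -- `ω([Γ, N]) = ω([Γ₁, N₁])` with `𝒪 = (α₁)_#⁻¹ 𝒪₁ β₁`
    (hω₁ : SpaceGroups.omegaMap p.cl = SpaceGroups.omegaMap p₁.cl)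
    (α₁ : p.1.N ≃* p₁.1.N) (β₁ : p.1.Γ ⧸ p.1.N ≃* p₁.1.Γ ⧸ p₁.1.N)
    (h₁ : p.1.O = (SpaceGroups.sharp α₁).symm.toMonoidHom.comp (p₁.1.O.comp β₁.toMonoidHom))
    -- `ω([Γ, N]) = ω([Γ₂, N₂])` with `𝒪 = (α₂)_#⁻¹ 𝒪₂ β₂`
    (hω₂ : SpaceGroups.omegaMap p.cl = SpaceGroups.omegaMap p₂.cl)
    (α₂ : p.1.N ≃* p₂.1.N) (β₂ : p.1.Γ ⧸ p.1.N ≃* p₂.1.Γ ⧸ p₂.1.N)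
    (h₂ : p.1.O = (SpaceGroups.sharp α₂).symm.toMonoidHom.comp (p₂.1.O.comp β₂.toMonoidHom))
    -- the two fiber cohomology classes are in the same coset of the image of `κ_*`
    (hcoset : (Submodule.Quotient.mk (SpaceGroups.Pair.fiberClass α₁ β₁ h₁) :
        groupCohomology.H1 p.1.repK ⧸ LinearMap.range p.1.kappaStar)
      = Submodule.Quotient.mk (SpaceGroups.Pair.fiberClass α₂ β₂ h₂)) :
    p₁.cl = p₂.cl := by
  obtain ⟨c, hc, d, hd⟩ := SpaceGroups.Pair.exists_cocycle_of_fiberClass hcoset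
  obtain ⟨F, hF⟩ := SpaceGroups.Pair.exists_fiberProd_equiv
    (φ := SpaceGroups.Pair.phiHom α₂ β₂) (ψ := SpaceGroups.Pair.phiHom α₁ β₁)
    (SpaceGroups.Pair.phi_mem α₂ β₂ h₂) hc d hd
  exact Eq.symm (Quotient.sound (SpaceGroups.Pair.pairIso_of_fiberProd_equiv F hF))
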